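/- Let $\mathbb{F}$ be a field and $V=\mathbb{F}^2\otimes\mathbb{F}^3\otimes\mathbb{F}^3$. A fundamental tensor is one of the form $v_1\otimes v_2\otimes v_3$ with all $v_i\neq 0$. Let $G$ be the setwise stabiliser in $\mathrm{GL}(V)$ of the set of fundamental tensors, and let $H\le G$ be the image of $\mathrm{GL}(\mathbb{F}^2)\times\mathrm{GL}(\mathbb{F}^3)\times\mathrm{GL}(\mathbb{F}^3)$ acting by $v_1\otimes v_2\otimes v_3\mapsto g_1v_1\otimes g_2v_2\otimes g_3v_3$. A constant-rank-3 pencil is a two-dimensional subspace of $\mathbb{F}^3\otimes\mathbb{F}^3$ all of whose nonzero elements have tensor rank $3$. Orbits are counted on all of $V$, so $\{0\}$ is one of them. (i) If $\mathbb{F}$ is algebraically closed, then there is no constant-rank-3 pencil in $\mathbb{F}^3\otimes\mathbb{F}^3$, and there are precisely $18$ $H$-orbits and precisely $15$ $G$-orbits of tensors in $V$. (ii) If $\mathbb{F}$ is real closed, then there is no constant-rank-3 pencil in $\mathbb{F}^3\otimes\mathbb{F}^3$, and there are precisely $20$ $H$-orbits and precisely $17$ $G$-orbits of tensors in $V$.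 In particular, there are precisely $20$ $H$-orbits and precisely $17$ $G$-orbits of tensors in $\mathbb{R}^2\otimes\mathbb{R}^3\otimes\mathbb{R}^3$. -/

import Mathlib

open scoped TensorProduct Pointwise

noncomputable section

namespace TensorOrbits

/-- The fundamental (rank one) tensors of `V ⊗ W`: the tensors `v ⊗ w` with `v`, `w` nonzero. -/
def fundamentalTwo (F V W : Type*) [Field F] [AddCommGroup V] [Module F V]
    [AddCommGroup W] [Module F W] : Set (V ⊗[F] W) :=
  {t | ∃ (v : V) (w : W), v ≠ 0 ∧ w ≠ 0 ∧ t = v ⊗ₜ[F] w}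

/-- The fundamental (rank one) tensors of `V₁ ⊗ V₂ ⊗ V₃`: the tensors `v₁ ⊗ v₂ ⊗ v₃` with all
`vᵢ` nonzero. -/
def fundamentalThree (F V₁ V₂ V₃ : Type*) [Field F] [AddCommGroup V₁] [Module F V₁]
    [AddCommGroup V₂] [Module F V₂] [AddCommGroup V₃] [Module F V₃] :
    Set (V₁ ⊗[F] (V₂ ⊗[F] V₃)) :=
  {t | ∃ (v₁ : V₁) (v₂ : V₂) (v₃ : V₃), v₁ ≠ 0 ∧ v₂ ≠ 0 ∧ v₃ ≠ 0 ∧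
    t = v₁ ⊗ₜ[F] (v₂ ⊗ₜ[F] v₃)}

/-- The rank of a tensor `t` in `V ⊗ W`: the least `k` such that `t` lies in the span of `k`
fundamental tensors. -/
def tensorRank {F V W : Type*} [Field F] [AddCommGroup V] [Module F V]
    [AddCommGroup W] [Module F W] (t : V ⊗[F] W) : ℕ :=
  sInf {k : ℕ | ∃ α : Fin k → V ⊗[F] W,
    (∀ i, α i ∈ fundamentalTwo F V W) ∧ t ∈ Submodule.span F (Set.range α)}

/-- A pencil of constant rank `r`: a two-dimensional subspace of `V ⊗ W` (a line of the
projective space) all of whose nonzero elements have rank `r`. -/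
def IsConstantRankPencil {F V W : Type*} [Field F] [AddCommGroup V] [Module F V]
    [AddCommGroup W] [Module F W] (r : ℕ) (L : Submodule F (V ⊗[F] W)) : Prop :=
  Module.finrank F L = 2 ∧ ∀ t ∈ L, t ≠ 0 → tensorRank t = r

/-- The group `G`: the setwise stabiliser in `GL(V₁ ⊗ V₂ ⊗ V₃)` of the set of fundamental
tensors. -/
def groupG (F V₁ V₂ V₃ : Type*) [Field F] [AddCommGroup V₁] [Module F V₁]
    [AddCommGroup V₂] [Module F V₂] [AddCommGroup V₃] [Module F V₃] :
    Subgroup ((V₁ ⊗[F] (V₂ ⊗[F] V₃)) ≃ₗ[F] (V₁ ⊗[F] (V₂ ⊗[F] V₃))) :=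
  MulAction.stabilizer ((V₁ ⊗[F] (V₂ ⊗[F] V₃)) ≃ₗ[F] (V₁ ⊗[F] (V₂ ⊗[F] V₃)))
    (fundamentalThree F V₁ V₂ V₃)

/-- The action of `GL(V₁) × GL(V₂) × GL(V₃)` on `V₁ ⊗ V₂ ⊗ V₃`, determined by
`v₁ ⊗ v₂ ⊗ v₃ ↦ g₁ v₁ ⊗ g₂ v₂ ⊗ g₃ v₃`. -/
def productHom (F V₁ V₂ V₃ : Type*) [Field F] [AddCommGroup V₁] [Module F V₁]
    [AddCommGroup V₂] [Module F V₂] [AddCommGroup V₃] [Module F V₃] :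
    ((V₁ ≃ₗ[F] V₁) × (V₂ ≃ₗ[F] V₂) × (V₃ ≃ₗ[F] V₃)) →*
      ((V₁ ⊗[F] (V₂ ⊗[F] V₃)) ≃ₗ[F] (V₁ ⊗[F] (V₂ ⊗[F] V₃))) where
  toFun g := TensorProduct.congr g.1 (TensorProduct.congr g.2.1 g.2.2)
  map_one' := by
    apply LinearEquiv.toLinearMap_injective
    ext
    rfl
  map_mul' g h := by
    simp only [Prod.fst_mul, Prod.snd_mul, TensorProduct.congr_mul]

/-- The group `H`: the image of `GL(V₁) × GL(V₂) × GL(V₃)` in `GL(V₁ ⊗ V₂ ⊗ V₃)`. -/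
def groupH (F V₁ V₂ V₃ : Type*) [Field F] [AddCommGroup V₁] [Module F V₁]
    [AddCommGroup V₂] [Module F V₂] [AddCommGroup V₃] [Module F V₃] :
    Subgroup ((V₁ ⊗[F] (V₂ ⊗[F] V₃)) ≃ₗ[F] (V₁ ⊗[F] (V₂ ⊗[F] V₃))) :=
  (productHom F V₁ V₂ V₃).range

/-- The tensor space `F² ⊗ F³ ⊗ F³`. -/
abbrev Space (F : Type*) [Field F] : Type _ :=
  (Fin 2 → F) ⊗[F] ((Fin 3 → F) ⊗[F] (Fin 3 → F))

/-- The set of `G`-orbits of tensors in `F² ⊗ F³ ⊗ F³` (the zero tensor included). -/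
abbrev GOrbits (F : Type*) [Field F] : Type _ :=
  MulAction.orbitRel.Quotient (groupG F (Fin 2 → F) (Fin 3 → F) (Fin 3 → F)) (Space F)

/-- The set of `H`-orbits of tensors in `F² ⊗ F³ ⊗ F³` (the zero tensor included). -/
abbrev HOrbits (F : Type*) [Field F] : Type _ :=
  MulAction.orbitRel.Quotient (groupH F (Fin 2 → F) (Fin 3 → F) (Fin 3 → F)) (Space F)

end TensorOrbits

end

/-! A tensor in `F² ⊗ F³ ⊗ F³` is a pair of `3 × 3` matrices, that is, a pencil `x₀ A + x₁ B`. The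
group `H` acts by substitution of the parameters and by simultaneous row and column operations
(`orbitRel_groupH_iff`), so its orbits are the equivalence classes of pencils.

The determinant of a pencil is a binary cubic form. Over an algebraically closed or a real closed
field every cubic polynomial has a root, so every pencil has a singular member with nonzero
parameter. A singular `3 × 3` matrix has tensor rank at most two, which excludes constant-rank-3
pencils. Taking the singular member as second matrix and putting it in diagonal form, elimination
leads to one of eighteen normal forms, unless a `2 × 2` block remains whose characteristic
polynomial has no root (`isClassified_of_det_eq_zero`). Such a block does not exist over an
algebraically closed field. Over a real closed field completing the square leaves a single block,
with determinant `-(x₀² + x₁²)`, alone or next to a nonzero corner: two more forms.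

The forms are inequivalent because they differ in invariants: common kernels, members of rank at
most one, the zeros of the determinant and their multiplicity. These are collected in
`Pencil.index`.

For `G`, since `2 < 3`, an automorphism preserving fundamental tensors respects the first factor,
and on `F³ ⊗ F³` it is a product map up to interchanging the factors. Hence `G` is generated by `H`
and transposition (`mem_groupH_or_of_mem_groupG`). Transposition exchanges three pairs of normal
forms and fixes the others, so three orbits are lost. -/

namespace TensorOrbits

open Matrix

/-! ### Pencils of matrices and their equivalence -/

/-- The pencils of `3 × 3` matrices. -/
abbrev Pencil (F : Type*) : Type _ := Fin 2 → Matrix (Fin 3) (Fin 3) F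

variable {F : Type*} [Field F]

/-- Equivalence of pencils: change of the parameters, and simultaneous row and column
operations. -/
def PencilEquiv (S T : Pencil F) : Prop :=
  ∃ (g : Matrix (Fin 2) (Fin 2) F) (P Q : Matrix (Fin 3) (Fin 3) F),
    g.det ≠ 0 ∧ P.det ≠ 0 ∧ Q.det ≠ 0 ∧ ∀ i, T i = ∑ j, g i j • (P * S j * Q)

namespace PencilEquiv

theorem refl (T : Pencil F) : PencilEquiv T T :=
  ⟨1, 1, 1, by simp, by simp, by simp, fun i => by simp [Matrix.one_apply]⟩

theorem trans {S T U : Pencil F} (h : PencilEquiv S T) (h' : PencilEquiv T U) :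
    PencilEquiv S U := by
  obtain ⟨g, P, Q, hg, hP, hQ, h⟩ := h
  obtain ⟨g', P', Q', hg', hP', hQ', h'⟩ := h'
  refine ⟨g' * g, P' * P, Q * Q', by simp [*], by simp [*], by simp [*], fun i => ?_⟩
  simp only [h', h, Fin.sum_univ_two, Matrix.mul_apply, Matrix.mul_add, Matrix.add_mul,
    Matrix.mul_smul, Matrix.smul_mul, Matrix.mul_assoc, smul_add, smul_smul, add_smul]
  abel

theorem symm {S T : Pencil F} (h : PencilEquiv S T) : PencilEquiv T S := by
  obtain ⟨g, P, Q, hg, hP, hQ, h⟩ := h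
  refine ⟨g⁻¹, P⁻¹, Q⁻¹, by simp [Matrix.det_nonsing_inv, hg], by simp [Matrix.det_nonsing_inv, hP],
    by simp [Matrix.det_nonsing_inv, hQ], fun i => ?_⟩
  have key : ∀ M : Matrix (Fin 3) (Fin 3) F, P⁻¹ * (P * M * Q) * Q⁻¹ = M := fun M => by
    rw [Matrix.mul_assoc P, Matrix.nonsing_inv_mul_cancel_left _ _ hP.isUnit,
      Matrix.mul_nonsing_inv_cancel_right _ _ hQ.isUnit]
  have hg1 : g⁻¹ * g = 1 := Matrix.nonsing_inv_mul _ hg.isUnit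
  have h2 : ∀ i, ∑ j, g⁻¹ i j • (P⁻¹ * T j * Q⁻¹) = ∑ k, (g⁻¹ * g) i k • S k := by
    intro i
    simp only [h, Fin.sum_univ_two, Matrix.mul_apply, Matrix.mul_add, Matrix.add_mul,
      Matrix.mul_smul, Matrix.smul_mul, key, smul_add, smul_smul, add_smul]
    abel
  rw [h2, hg1]
  simp [Matrix.one_apply]

theorem of_mul {A B A' B' : Matrix (Fin 3) (Fin 3) F} (P Q : Matrix (Fin 3) (Fin 3) F)
    (hP : P.det ≠ 0) (hQ : Q.det ≠ 0) (hA : P * A * Q = A') (hB : P * B * Q = B') :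
    PencilEquiv ![A, B] ![A', B'] :=
  ⟨1, P, Q, by simp, hP, hQ, fun i => by
    fin_cases i <;> simp [Matrix.one_apply, hA, hB]⟩

theorem of_comb (A B : Matrix (Fin 3) (Fin 3) F) (a b c d : F) (h : a * d - b * c ≠ 0) :
    PencilEquiv ![A, B] ![a • A + b • B, c • A + d • B] :=
  ⟨!![a, b; c, d], 1, 1, by simpa [Matrix.det_fin_two] using h, by simp, by simp, fun i => by
    fin_cases i <;> simp⟩

theorem shift (A B : Matrix (Fin 3) (Fin 3) F) (b : F) :
    PencilEquiv ![A, B] ![A + b • B, B] := by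
  simpa using of_comb A B 1 b 0 1 (by simp)

theorem swap (A B : Matrix (Fin 3) (Fin 3) F) :
    PencilEquiv ![A, B] ![B, A] := by
  simpa using of_comb A B 0 1 1 0 (by simp)

theorem transpose {S T : Pencil F} (h : PencilEquiv S T) :
    PencilEquiv (fun i => (S i)ᵀ) (fun i => (T i)ᵀ) := by
  obtain ⟨g, P, Q, hg, hP, hQ, h⟩ := h
  refine ⟨g, Qᵀ, Pᵀ, hg, by simpa using hQ, by simpa using hP, fun i => ?_⟩
  simp [h, Fin.sum_univ_two, Matrix.transpose_mul, Matrix.mul_assoc]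

end PencilEquiv

/-- Every square matrix is equivalent to a diagonal one with entries `0` and `1`. -/
theorem exists_mul_mul_eq_diagonal {n : Type*} [Fintype n] [DecidableEq n] (M : Matrix n n F) :
    ∃ (P Q : Matrix n n F) (d : n → F), P.det ≠ 0 ∧ Q.det ≠ 0 ∧ (∀ i, d i = 0 ∨ d i = 1) ∧
      P * M * Q = diagonal d := by
  classical
  obtain ⟨L, L', D, h⟩ := Matrix.Pivot.exists_list_transvec_mul_mul_list_transvec_eq_diagonal M
  refine ⟨diagonal (fun i => if D i = 0 then 1 else (D i)⁻¹) *
    (L.map Matrix.TransvectionStruct.toMatrix).prod,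
    (L'.map Matrix.TransvectionStruct.toMatrix).prod, fun i => if D i = 0 then 0 else 1,
    ?_, by simp, fun i => by by_cases hi : D i = 0 <;> simp [hi], ?_⟩
  · rw [Matrix.det_mul, Matrix.det_diagonal]
    simp only [Matrix.TransvectionStruct.det_toMatrix_prod, mul_one]
    refine Finset.prod_ne_zero_iff.2 fun i _ => ?_
    by_cases hi : D i = 0 <;> simp [hi]
  · rw [Matrix.mul_assoc, Matrix.mul_assoc, ← Matrix.mul_assoc _ M, h, Matrix.diagonal_mul_diagonal]
    congr 1
    ext i
    by_cases hi : D i = 0 <;> simp [hi]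

/-! ### Normal forms, and the reduction of pencils with a singular member -/

/-- The normal forms of pencils of `3 × 3` matrices. -/
def normalForm (F : Type*) [Field F] : Fin 20 → Pencil F := ![
  ![0, 0],
  ![!![1, 0, 0; 0, 0, 0; 0, 0, 0], 0],
  ![!![0, 0, 0; 0, 1, 0; 0, 0, 1], 0],
  ![!![1, 0, 0; 0, 1, 0; 0, 0, 1], 0],
  ![!![0, 1, 0; 0, 0, 0; 0, 0, 0], !![1, 0, 0; 0, 0, 0; 0, 0, 0]],
  ![!![0, 1, 0; 1, 0, 0; 0, 0, 0], !![1, 0, 0; 0, 0, 0; 0, 0, 0]],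
  ![!![0, 0, 0; 0, 0, 0; 0, 0, 1], !![1, 0, 0; 0, 0, 0; 0, 0, 0]],
  ![!![0, 1, 0; 0, 0, 0; 0, 0, 1], !![1, 0, 0; 0, 0, 0; 0, 0, 0]],
  ![!![0, 1, 0; 0, 0, 1; 0, 0, 0], !![0, 0, 0; 0, 1, 0; 0, 0, 1]],
  ![!![0, 0, 1; 0, 0, 0; 1, 0, 0], !![0, 0, 0; 0, 0, 1; 0, 1, 0]],
  ![!![0, 0, 1; 0, 1, 0; 1, 0, 0], !![0, 0, 0; 0, 0, 1; 0, 1, 0]],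
  ![!![0, 1, 0; 1, 0, 0; 0, 0, 1], !![1, 0, 0; 0, 0, 0; 0, 0, 0]],
  ![!![0, 1, 0; 1, 0, 0; 0, 0, 0], !![0, 0, 0; 0, 1, 0; 0, 0, 1]],
  ![!![0, 0, 0; 0, 1, 0; 0, 0, 1], !![1, 0, 0; 0, 0, 0; 0, 0, 0]],
  ![!![1, 0, 0; 0, 0, 0; 0, 0, 1], !![0, 0, 0; 0, 1, 0; 0, 0, 1]],
  -- Forms 15, 16 and 17 are the transposes of forms 4, 7 and 8; all the others are symmetric.
  ![!![0, 0, 0; 1, 0, 0; 0, 0, 0], !![1, 0, 0; 0, 0, 0; 0, 0, 0]],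
  ![!![0, 0, 0; 1, 0, 0; 0, 0, 1], !![1, 0, 0; 0, 0, 0; 0, 0, 0]],
  ![!![0, 0, 0; 1, 0, 0; 0, 1, 0], !![0, 0, 0; 0, 1, 0; 0, 0, 1]],
  -- The lower block of the last two forms has determinant `-(x₀² + x₁²)`; they are new only if this
  -- form is anisotropic.
  ![!![0, 0, 0; 0, 1, 0; 0, 0, -1], !![0, 0, 0; 0, 0, 1; 0, 1, 0]],
  ![!![1, 0, 0; 0, 1, 0; 0, 0, -1], !![0, 0, 0; 0, 0, 1; 0, 1, 0]]]

theorem zero_eq_vec_three : (0 : Fin 3 → F) = ![0, 0, 0] := by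
  ext i; fin_cases i <;> rfl

/-- The pencil is equivalent to one of the first eighteen normal forms, or splits off a
`2 × 2` pencil whose determinant has no zeros. -/
def IsClassified (T : Pencil F) : Prop :=
  (∃ i : Fin 20, i < 18 ∧ PencilEquiv T (normalForm F i)) ∨
  ∃ a p q : F, (a = 0 ∨ a = 1) ∧ (∀ x : F, x ^ 2 + p * x + q ≠ 0) ∧
    PencilEquiv T ![!![a, 0, 0; 0, 0, -q; 0, 1, -p], !![0, 0, 0; 0, 1, 0; 0, 0, 1]]

theorem IsClassified.of_equiv {S T : Pencil F} (h : PencilEquiv S T) (hT : IsClassified T) :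
    IsClassified S := by
  rcases hT with ⟨i, hi, h'⟩ | ⟨a, p, q, ha, hpq, h'⟩
  · exact Or.inl ⟨i, hi, h.trans h'⟩
  · exact Or.inr ⟨a, p, q, ha, hpq, h.trans h'⟩

theorem IsClassified.of_mul {A B A' B' : Matrix (Fin 3) (Fin 3) F} (h : IsClassified ![A', B'])
    (P Q : Matrix (Fin 3) (Fin 3) F)
    (hP : P.det ≠ 0) (hQ : Q.det ≠ 0) (hA : P * A * Q = A') (hB : P * B * Q = B') :
    IsClassified ![A, B] := h.of_equiv (.of_mul P Q hP hQ hA hB)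

theorem IsClassified.swap {A B : Matrix (Fin 3) (Fin 3) F} (h : IsClassified ![A, B]) :
    IsClassified ![B, A] := h.of_equiv (.swap _ _)

theorem isClassified_normalForm (i : Fin 20) (hi : i < 18) : IsClassified (normalForm F i) :=
  Or.inl ⟨i, hi, .refl _⟩

theorem isClassified_zero_right (A : Matrix (Fin 3) (Fin 3) F) : IsClassified ![A, 0] := by
  obtain ⟨P, Q, d, hP, hQ, hd, h⟩ := exists_mul_mul_eq_diagonal A
  refine IsClassified.of_mul (A' := diagonal d) (B' := 0) ?_ P Q hP hQ h (by simp)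
  have e : diagonal d = !![d 0, 0, 0; 0, d 1, 0; 0, 0, d 2] := by
    ext i j; fin_cases i <;> fin_cases j <;> simp
  rw [e]
  rcases hd 0 with h0 | h0 <;> rcases hd 1 with h1 | h1 <;> rcases hd 2 with h2 | h2 <;>
    rw [h0, h1, h2]
  · convert isClassified_normalForm 0 (by decide) using 1
    ext i j k; fin_cases i <;> fin_cases j <;> fin_cases k <;> simp [normalForm]
  · refine (show IsClassified (F := F) ![!![1, 0, 0; 0, 0, 0; 0, 0, 0], 0] from
      isClassified_normalForm 1 (by decide)).of_mul !![0, 0, 1; 0, 1, 0; 1, 0, 0]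
      !![0, 0, 1; 0, 1, 0; 1, 0, 0] ?_ ?_ ?_ ?_ <;> simp [zero_eq_vec_three, det_fin_three]
  · refine (show IsClassified (F := F) ![!![1, 0, 0; 0, 0, 0; 0, 0, 0], 0] from
      isClassified_normalForm 1 (by decide)).of_mul !![0, 1, 0; 1, 0, 0; 0, 0, 1]
      !![0, 1, 0; 1, 0, 0; 0, 0, 1] ?_ ?_ ?_ ?_ <;> simp [zero_eq_vec_three, det_fin_three]
  · exact isClassified_normalForm 2 (by decide)
  · exact isClassified_normalForm 1 (by decide)
  · refine (show IsClassified (F := F) ![!![0, 0, 0; 0, 1, 0; 0, 0, 1], 0] from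
      isClassified_normalForm 2 (by decide)).of_mul !![0, 1, 0; 1, 0, 0; 0, 0, 1]
      !![0, 1, 0; 1, 0, 0; 0, 0, 1] ?_ ?_ ?_ ?_ <;> simp [zero_eq_vec_three, det_fin_three]
  · refine (show IsClassified (F := F) ![!![0, 0, 0; 0, 1, 0; 0, 0, 1], 0] from
      isClassified_normalForm 2 (by decide)).of_mul !![0, 0, 1; 0, 1, 0; 1, 0, 0]
      !![0, 0, 1; 0, 1, 0; 1, 0, 0] ?_ ?_ ?_ ?_ <;> simp [zero_eq_vec_three, det_fin_three]
  · exact isClassified_normalForm 3 (by decide)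

/-- A vector of length two can be moved to `0` or to the first basis vector. -/
theorem exists_row_reduction (r₁ r₂ : F) : ∃ s₁₁ s₁₂ s₂₁ s₂₂ ε : F, (ε = 0 ∨ ε = 1) ∧
    s₁₁ * s₂₂ - s₁₂ * s₂₁ ≠ 0 ∧ r₁ * s₁₁ + r₂ * s₂₁ = ε ∧ r₁ * s₁₂ + r₂ * s₂₂ = 0 := by
  by_cases h1 : r₁ = 0
  · by_cases h2 : r₂ = 0
    · exact ⟨1, 0, 0, 1, 0, by simp [h1, h2]⟩
    · exact ⟨0, 1, r₂⁻¹, 0, 1, by simp [h1, h2]⟩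
  · exact ⟨r₁⁻¹, -r₂ / r₁, 0, 1, 1, by simp, by simp [h1], by simp [h1], by field_simp; ring⟩

/-- Operations on the last two columns act on `(r₁, r₂)` alone, those on the last two rows act on
`(c₁, c₂)` alone, and both fix the second matrix. So the two vectors can be normalised
independently. -/
theorem isClassified_corner_zero (r₁ r₂ c₁ c₂ : F) :
    IsClassified ![!![0, r₁, r₂; c₁, 0, 0; c₂, 0, 0], !![1, 0, 0; 0, 0, 0; 0, 0, 0]] := by
  obtain ⟨s₁₁, s₁₂, s₂₁, s₂₂, ε, hε, hs, h1, h2⟩ := exists_row_reduction r₁ r₂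
  obtain ⟨t₁₁, t₁₂, t₂₁, t₂₂, η, hη, ht, k1, k2⟩ := exists_row_reduction c₁ c₂
  have k1' : t₁₁ * c₁ + t₂₁ * c₂ = η := by rw [← k1]; ring
  have k2' : t₁₂ * c₁ + t₂₂ * c₂ = 0 := by rw [← k2]; ring
  suffices h : IsClassified ![!![0, ε, 0; η, 0, 0; 0, 0, 0], !![1, 0, 0; 0, 0, 0; 0, 0, 0]] by
    refine h.of_mul !![1, 0, 0; 0, t₁₁, t₂₁; 0, t₁₂, t₂₂] !![1, 0, 0; 0, s₁₁, s₁₂; 0, s₂₁, s₂₂]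
      (by simpa [det_fin_three, mul_comm] using ht) (by simpa [det_fin_three] using hs)
      (by simp [zero_eq_vec_three, h1, h2, k1', k2']) (by simp [zero_eq_vec_three])
  rcases hε with rfl | rfl <;> rcases hη with rfl | rfl
  · refine IsClassified.swap ?_
    convert isClassified_zero_right _ using 2
    congr 1
    ext i j; fin_cases i <;> fin_cases j <;> rfl
  · exact isClassified_normalForm 15 (by decide)
  · exact isClassified_normalForm 4 (by decide)
  · exact isClassified_normalForm 5 (by decide)

theorem isClassified_corner_one (r c : F) :
    IsClassified ![!![0, r, 0; c, 0, 0; 0, 0, 1], !![1, 0, 0; 0, 0, 0; 0, 0, 0]] := by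
  by_cases hr : r = 0 <;> by_cases hc : c = 0
  · subst hr hc
    exact isClassified_normalForm 6 (by decide)
  · refine (show IsClassified (F := F)
      ![!![0, 0, 0; 1, 0, 0; 0, 0, 1], !![1, 0, 0; 0, 0, 0; 0, 0, 0]] from
      isClassified_normalForm 16 (by decide)).of_mul !![1, 0, 0; 0, c⁻¹, 0; 0, 0, 1] 1
      ?_ ?_ ?_ ?_ <;> simp [zero_eq_vec_three, det_fin_three, hr, hc]
  · refine (show IsClassified (F := F)
      ![!![0, 1, 0; 0, 0, 0; 0, 0, 1], !![1, 0, 0; 0, 0, 0; 0, 0, 0]] from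
      isClassified_normalForm 7 (by decide)).of_mul 1 !![1, 0, 0; 0, r⁻¹, 0; 0, 0, 1]
      ?_ ?_ ?_ ?_ <;> simp [zero_eq_vec_three, det_fin_three, hr, hc]
  · refine (show IsClassified (F := F)
      ![!![0, 1, 0; 1, 0, 0; 0, 0, 1], !![1, 0, 0; 0, 0, 0; 0, 0, 0]] from
      isClassified_normalForm 11 (by decide)).of_mul !![1, 0, 0; 0, c⁻¹, 0; 0, 0, 1]
      !![1, 0, 0; 0, r⁻¹, 0; 0, 0, 1] ?_ ?_ ?_ ?_ <;> simp [zero_eq_vec_three, det_fin_three, hr, hc]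

/-- Multiples of the last two rows and columns are added to the first ones, which does not affect
the second matrix. The corner entry that results is cancelled beforehand by a multiple of the second
matrix, so its value never matters. -/
theorem isClassified_corner_clear (a r₁ r₂ c₁ c₂ d₁ d₂ p₁ p₂ q₁ q₂ : F)
    (h : IsClassified ![!![0, r₁ + p₁ * d₁, r₂ + p₂ * d₂; c₁ + q₁ * d₁, d₁, 0;
      c₂ + q₂ * d₂, 0, d₂], !![1, 0, 0; 0, 0, 0; 0, 0, 0]]) :
    IsClassified ![!![a, r₁, r₂; c₁, d₁, 0; c₂, 0, d₂], !![1, 0, 0; 0, 0, 0; 0, 0, 0]] := by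
  refine IsClassified.of_equiv (.shift _ _
    (-(a + p₁ * c₁ + p₂ * c₂ + (r₁ + p₁ * d₁) * q₁ + (r₂ + p₂ * d₂) * q₂))) ?_
  refine h.of_mul !![1, p₁, p₂; 0, 1, 0; 0, 0, 1] !![1, 0, 0; q₁, 1, 0; q₂, 0, 1]
    (by simp [det_fin_three]) (by simp [det_fin_three]) ?_ (by simp [zero_eq_vec_three])
  ext i j; fin_cases i <;> fin_cases j <;> simp <;> ring

/-- A pencil containing a matrix of rank one is classified. -/
theorem isClassified_corner (A : Matrix (Fin 3) (Fin 3) F) :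
    IsClassified ![A, !![1, 0, 0; 0, 0, 0; 0, 0, 0]] := by
  -- Operations on the last two rows and columns fix the rank one matrix, so the complementary block
  -- can be made diagonal.
  obtain ⟨P, Q, d, hP, hQ, hd, h⟩ := exists_mul_mul_eq_diagonal !![A 1 1, A 1 2; A 2 1, A 2 2]
  suffices h' : ∀ a r₁ r₂ c₁ c₂ : F, IsClassified ![!![a, r₁, r₂; c₁, d 0, 0; c₂, 0, d 1],
      !![1, 0, 0; 0, 0, 0; 0, 0, 0]] by
    have h00 := congrFun (congrFun h 0) 0
    have h01 := congrFun (congrFun h 0) 1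
    have h10 := congrFun (congrFun h 1) 0
    have h11 := congrFun (congrFun h 1) 1
    simp [Matrix.mul_apply, Fin.sum_univ_two] at h00 h01 h10 h11
    refine (h' (A 0 0) (A 0 1 * Q 0 0 + A 0 2 * Q 1 0) (A 0 1 * Q 0 1 + A 0 2 * Q 1 1)
      (P 0 0 * A 1 0 + P 0 1 * A 2 0) (P 1 0 * A 1 0 + P 1 1 * A 2 0)).of_mul
      !![1, 0, 0; 0, P 0 0, P 0 1; 0, P 1 0, P 1 1] !![1, 0, 0; 0, Q 0 0, Q 0 1; 0, Q 1 0, Q 1 1]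
      (by simpa [det_fin_three, det_fin_two] using hP)
      (by simpa [det_fin_three, det_fin_two] using hQ) ?_ (by simp [zero_eq_vec_three])
    rw [A.eta_fin_three]
    simp [h00, h01, h10, h11]
  intro a r₁ r₂ c₁ c₂
  rcases hd 0 with h0 | h0 <;> rcases hd 1 with h1 | h1 <;> rw [h0, h1]
  · refine isClassified_corner_clear _ _ _ _ _ _ _ 0 0 0 0 ?_
    simpa using isClassified_corner_zero _ _ _ _
  · refine isClassified_corner_clear _ _ _ _ _ _ _ 0 (-r₂) 0 (-c₂) ?_
    simpa using isClassified_corner_one _ _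
  · refine isClassified_corner_clear _ _ _ _ _ _ _ (-r₁) 0 (-c₁) 0 ?_
    refine (isClassified_corner_one r₂ c₂).of_mul !![1, 0, 0; 0, 0, 1; 0, 1, 0]
      !![1, 0, 0; 0, 0, 1; 0, 1, 0] ?_ ?_ ?_ ?_ <;> simp [zero_eq_vec_three, det_fin_three]
  · refine isClassified_corner_clear _ _ _ _ _ _ _ (-r₁) (-r₂) (-c₁) (-c₂) ?_
    simp only [mul_one, add_neg_cancel]
    exact isClassified_normalForm 13 (by decide)

theorem isClassified_vecMulVec (A : Matrix (Fin 3) (Fin 3) F) (y z : Fin 3 → F) :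
    IsClassified ![A, vecMulVec y z] := by
  obtain ⟨P, Q, d, hP, hQ, hd, h⟩ := exists_mul_mul_eq_diagonal (vecMulVec y z)
  refine IsClassified.of_mul ?_ P Q hP hQ rfl h
  generalize P * A * Q = A
  -- The `2 × 2` minors of a matrix of rank at most one vanish, so at most one diagonal entry
  -- survives.
  have hm : ∀ i j, i ≠ j → d i * d j = 0 := by
    intro i j hij
    have e : P * vecMulVec y z * Q = vecMulVec (P *ᵥ y) (z ᵥ* Q) := by
      rw [Matrix.mul_vecMulVec, Matrix.vecMulVec_mul]
    rw [e] at h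
    have h1 := congrFun (congrFun h i) i
    have h2 := congrFun (congrFun h j) j
    have h3 := congrFun (congrFun h i) j
    simp [vecMulVec_apply, hij] at h1 h2 h3
    rw [← h1, ← h2]
    rcases h3 with h3 | h3 <;> simp [h3]
  have e : diagonal d = !![d 0, 0, 0; 0, d 1, 0; 0, 0, d 2] := by
    ext i j; fin_cases i <;> fin_cases j <;> simp
  have h01 := hm 0 1 (by decide)
  have h02 := hm 0 2 (by decide)
  have h12 := hm 1 2 (by decide)
  rw [e]
  rcases hd 0 with h0 | h0 <;> rcases hd 1 with h1 | h1 <;> rcases hd 2 with h2 | h2 <;>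
    simp only [h0, h1, h2, mul_one, one_ne_zero] at h01 h02 h12 ⊢
  · convert isClassified_zero_right A using 2
    congr 1
    ext i j; fin_cases i <;> fin_cases j <;> simp
  · refine (isClassified_corner _).of_mul !![0, 0, 1; 0, 1, 0; 1, 0, 0]
      !![0, 0, 1; 0, 1, 0; 1, 0, 0] ?_ ?_ rfl ?_ <;> simp [zero_eq_vec_three, det_fin_three]
  · refine (isClassified_corner _).of_mul !![0, 1, 0; 1, 0, 0; 0, 0, 1]
      !![0, 1, 0; 1, 0, 0; 0, 0, 1] ?_ ?_ rfl ?_ <;> simp [zero_eq_vec_three, det_fin_three]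
  · exact isClassified_corner A

/-- A `2 × 2` matrix is scalar or similar to a companion matrix. -/
theorem eq_smul_one_or_similar_companion (D : Matrix (Fin 2) (Fin 2) F) :
    (∃ t : F, D = !![t, 0; 0, t]) ∨ ∃ (S S' : Matrix (Fin 2) (Fin 2) F) (p q : F),
      S * S' = 1 ∧ S * D * S' = !![0, -q; 1, -p] := by
  have key : ∀ (S : Matrix (Fin 2) (Fin 2) F) (p q : F), S.det ≠ 0 →
      D * S = S * !![0, -q; 1, -p] → ∃ (S S' : Matrix (Fin 2) (Fin 2) F) (p q : F),
      S * S' = 1 ∧ S * D * S' = !![0, -q; 1, -p] := by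
    intro S p q hS h
    refine ⟨S⁻¹, S, p, q, Matrix.nonsing_inv_mul _ hS.isUnit, ?_⟩
    rw [Matrix.mul_assoc, h, Matrix.nonsing_inv_mul_cancel_left _ _ hS.isUnit]
  have hD := D.eta_fin_two
  generalize D 0 0 = a at hD
  generalize D 0 1 = b at hD
  generalize D 1 0 = c at hD
  generalize D 1 1 = d at hD
  subst hD
  by_cases hc : c = 0
  · by_cases hb : b = 0
    · by_cases had : a = d
      · exact Or.inl ⟨a, by rw [hb, hc, had]⟩
      -- In each case the columns of `S` are `v` and `D v` for a vector `v` that is not an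
      -- eigenvector: here the sum of the two basis vectors, below one of them. The coefficients
      -- come from Cayley–Hamilton.
      · refine Or.inr (key !![1, a; 1, d] (-(a + d)) (a * d) ?_ ?_)
        · simpa [det_fin_two, sub_eq_zero] using Ne.symm had
        · ext i j; fin_cases i <;> fin_cases j <;> simp [hb, hc] <;> ring
    · refine Or.inr (key !![0, b; 1, d] (-(a + d)) (a * d - b * c) ?_ ?_)
      · simpa [det_fin_two] using hb
      · ext i j; fin_cases i <;> fin_cases j <;> simp [hc] <;> ring
  · refine Or.inr (key !![1, a; 0, c] (-(a + d)) (a * d - b * c) ?_ ?_)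
    · simpa [det_fin_two] using hc
    · ext i j; fin_cases i <;> fin_cases j <;> simp <;> ring

/-- If the quadratic has roots `t` and `t + m`, subtracting `t` times the second matrix makes the
block of rank one. For `a = 0` the whole matrix then has rank one. For `a = 1` a double root, `m =
0`, leads to form 12 and distinct roots lead to form 14. -/
theorem isClassified_companion (a p q : F) (ha : a = 0 ∨ a = 1) :
    IsClassified ![!![a, 0, 0; 0, 0, -q; 0, 1, -p], !![0, 0, 0; 0, 1, 0; 0, 0, 1]] := by
  by_cases h : ∀ x : F, x ^ 2 + p * x + q ≠ 0
  · exact Or.inr ⟨a, p, q, ha, h, .refl _⟩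
  push Not at h
  obtain ⟨t, ht⟩ := h
  obtain ⟨m, rfl⟩ : ∃ m, p = -(2 * t + m) := ⟨-p - 2 * t, by ring⟩
  obtain rfl : q = t * (t + m) := by linear_combination ht
  refine IsClassified.of_equiv (.shift _ _ (-t)) ?_
  have e : !![a, 0, 0; 0, 0, -(t * (t + m)); 0, 1, - -(2 * t + m)] +
      -t • !![0, 0, 0; 0, 1, 0; 0, 0, 1] = !![a, 0, 0; 0, -t, -t * (t + m); 0, 1, t + m] := by
    ext i j; fin_cases i <;> fin_cases j <;> simp <;> ring
  rw [e]
  rcases ha with rfl | rfl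
  · refine IsClassified.swap ?_
    convert isClassified_vecMulVec _ ![0, -t, 1] ![0, 1, t + m] using 2
    congr 1
    ext i j; fin_cases i <;> fin_cases j <;> simp [vecMulVec_apply]
  suffices h : IsClassified ![!![1, 0, 0; 0, 0, 0; 0, 1, m], !![0, 0, 0; 0, 1, 0; 0, 0, 1]] by
    refine h.of_mul !![1, 0, 0; 0, 1, t; 0, 0, 1] !![1, 0, 0; 0, 1, -t; 0, 0, 1] ?_ ?_ ?_ ?_ <;>
      simp [zero_eq_vec_three, det_fin_three]
  by_cases hm : m = 0
  · subst hm
    refine IsClassified.swap ((show IsClassified (F := F)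
      ![!![0, 1, 0; 1, 0, 0; 0, 0, 0], !![0, 0, 0; 0, 1, 0; 0, 0, 1]] from
      isClassified_normalForm 12 (by decide)).of_mul
      !![0, 1, 0; 0, 0, 1; 1, 0, 0] !![0, 0, 1; 0, 1, 0; 1, 0, 0] ?_ ?_ ?_ ?_) <;>
      simp [zero_eq_vec_three, det_fin_three]
  · refine IsClassified.of_equiv (.of_comb _ _ m⁻¹ 0 0 1 (by simpa using hm)) ?_
    refine (show IsClassified (F := F)
      ![!![1, 0, 0; 0, 0, 0; 0, 0, 1], !![0, 0, 0; 0, 1, 0; 0, 0, 1]] from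
      isClassified_normalForm 14 (by decide)).of_mul
      !![m, 0, 0; 0, m⁻¹, 0; 0, m⁻¹, 1] !![1, 0, 0; 0, m, 0; 0, -1, 1] ?_ ?_ ?_ ?_ <;>
      simp [zero_eq_vec_three, det_fin_three, hm]

/-- Conjugating the block preserves the second matrix, and the corner can be rescaled on its own.
For a scalar block a shift leaves only the corner, of rank at most one. -/
theorem isClassified_block (a : F) (D : Matrix (Fin 2) (Fin 2) F) :
    IsClassified ![!![a, 0, 0; 0, D 0 0, D 0 1; 0, D 1 0, D 1 1],
      !![0, 0, 0; 0, 1, 0; 0, 0, 1]] := by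
  rcases eq_smul_one_or_similar_companion D with ⟨t, rfl⟩ | ⟨S, S', p, q, hS, h⟩
  · refine IsClassified.of_equiv (.shift _ _ (-t)) (IsClassified.swap ?_)
    convert isClassified_vecMulVec _ ![a, 0, 0] ![1, 0, 0] using 2
    congr 1
    ext i j; fin_cases i <;> fin_cases j <;> simp [vecMulVec_apply]
  · have hdet : S.det * S'.det = 1 := by rw [← Matrix.det_mul, hS, Matrix.det_one]
    have hS1 : S.det ≠ 0 := left_ne_zero_of_mul_eq_one hdet
    have hS2 : S'.det ≠ 0 := right_ne_zero_of_mul_eq_one hdet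
    obtain ⟨b, hb, b', hb', hab⟩ : ∃ b : F, (b = 0 ∨ b = 1) ∧ ∃ b' : F, b' ≠ 0 ∧ b' * a = b := by
      by_cases ha : a = 0
      · exact ⟨0, Or.inl rfl, 1, one_ne_zero, by simp [ha]⟩
      · exact ⟨1, Or.inr rfl, a⁻¹, inv_ne_zero ha, by simp [ha]⟩
    have k := fun i j => congrFun (congrFun hS i) j
    have l := fun i j => congrFun (congrFun h i) j
    simp only [Matrix.mul_apply, Fin.sum_univ_two] at k l
    refine (isClassified_companion b p q hb).of_mul
      !![b', 0, 0; 0, S 0 0, S 0 1; 0, S 1 0, S 1 1]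
      !![1, 0, 0; 0, S' 0 0, S' 0 1; 0, S' 1 0, S' 1 1]
      (by simpa [det_fin_three, det_fin_two, mul_assoc, ← mul_sub, hb'] using hS1)
      (by simpa [det_fin_three, det_fin_two] using hS2) ?_ ?_
    · simp [zero_eq_vec_three, hab, l]
    · simp [zero_eq_vec_three, k]

/-- The determinant is `-x₀² (c₁ x₁ + (c₁ w - c₂ y) x₀)`. If `c₁ ≠ 0` it has a double and a simple
zero, and the form is 12. If `c₁ = 0` and `c₂ ≠ 0` it is a multiple of `x₀³`, zero exactly when `y =
0`: forms 10 and 9. If both vanish, the first column is zero. -/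
theorem isClassified_cleared (c₁ c₂ y w : F) :
    IsClassified ![!![0, 1, 0; c₁, 0, y; c₂, 0, w], !![0, 0, 0; 0, 1, 0; 0, 0, 1]] := by
  by_cases hc₁ : c₁ = 0
  · subst hc₁
    by_cases hc₂ : c₂ = 0
    · subst hc₂
      refine IsClassified.of_equiv (.shift _ _ (-w)) ?_
      suffices h : IsClassified ![!![0, 1, 0; 0, 0, y; 0, 0, 0], !![0, 0, 0; 0, 1, 0; 0, 0, 1]] by
        refine h.of_mul !![1, 0, 0; w, 1, 0; 0, 0, 1] 1 ?_ ?_ ?_ ?_ <;>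
          simp [zero_eq_vec_three, det_fin_three]
      by_cases hy : y = 0
      · subst hy
        refine IsClassified.swap ?_
        have e : (!![0, 1, 0; 0, 0, 0; 0, 0, 0] : Matrix (Fin 3) (Fin 3) F) = vecMulVec ![1, 0, 0] ![0, 1, 0] := by
          ext i j; fin_cases i <;> fin_cases j <;> simp [vecMulVec_apply]
        rw [e]
        exact isClassified_vecMulVec _ _ _
      · refine (show IsClassified (F := F)
          ![!![0, 1, 0; 0, 0, 1; 0, 0, 0], !![0, 0, 0; 0, 1, 0; 0, 0, 1]] from
          isClassified_normalForm 8 (by decide)).of_mul !![y⁻¹, 0, 0; 0, y⁻¹, 0; 0, 0, 1]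
          !![1, 0, 0; 0, y, 0; 0, 0, 1] ?_ ?_ ?_ ?_ <;>
          simp [zero_eq_vec_three, det_fin_three, hy]
    · suffices h : IsClassified ![!![0, 1, 0; 0, 0, y; 1, 0, 0], !![0, 0, 0; 0, 1, 0; 0, 0, 1]] by
        refine h.of_mul 1 !![c₂⁻¹, 0, -(w * c₂⁻¹); 0, 1, 0; 0, 0, 1] ?_ ?_ ?_ ?_ <;>
          simp [zero_eq_vec_three, det_fin_three, hc₂]
        field_simp
        simp
      by_cases hy : y = 0
      · subst hy
        refine (show IsClassified (F := F)
          ![!![0, 0, 1; 0, 0, 0; 1, 0, 0], !![0, 0, 0; 0, 0, 1; 0, 1, 0]] from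
          isClassified_normalForm 9 (by decide)).of_mul 1
          !![1, 0, 0; 0, 0, 1; 0, 1, 0] ?_ ?_ ?_ ?_ <;>
          simp [zero_eq_vec_three, det_fin_three]
      · refine (show IsClassified (F := F)
          ![!![0, 0, 1; 0, 1, 0; 1, 0, 0], !![0, 0, 0; 0, 0, 1; 0, 1, 0]] from
          isClassified_normalForm 10 (by decide)).of_mul !![y⁻¹, 0, 0; 0, y⁻¹, 0; 0, 0, 1]
          !![1, 0, 0; 0, 0, y; 0, 1, 0] ?_ ?_ ?_ ?_ <;>
          simp [zero_eq_vec_three, det_fin_three, hy]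
  · obtain ⟨k, rfl⟩ : ∃ k, c₂ = k * c₁ := ⟨c₂ / c₁, by field_simp⟩
    obtain ⟨w', rfl⟩ : ∃ w', w = w' + k * y := ⟨w - k * y, by ring⟩
    suffices h : IsClassified ![!![0, 1, 0; c₁, k * y, y; 0, k * w', w'],
        !![0, 0, 0; 0, 1, 0; 0, 0, 1]] by
      refine h.of_mul !![1, 0, 0; 0, 1, 0; 0, -k, 1] !![1, 0, 0; 0, 1, 0; 0, k, 1] ?_ ?_ ?_ ?_
      · simp [det_fin_three]
      · simp [det_fin_three]
      · ext i j; fin_cases i <;> fin_cases j <;> simp <;> ring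
      · simp [zero_eq_vec_three]
    -- With `c₂ = k c₁` and `w' = w - k y`, the simple zero of the determinant is at `x₁ = -w' x₀`;
    -- the shift moves it to the first matrix.
    refine IsClassified.of_equiv (.shift _ _ (-w')) ?_
    refine (show IsClassified (F := F)
      ![!![0, 1, 0; 1, 0, 0; 0, 0, 0], !![0, 0, 0; 0, 1, 0; 0, 0, 1]] from
      isClassified_normalForm 12 (by decide)).of_mul
      !![1, 0, 0; w' - k * y, 1, 0; -(k * w'), 0, 1]
      !![c₁⁻¹, 0, -(c₁⁻¹ * y); 0, 1, 0; 0, 0, 1] ?_ ?_ ?_ ?_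
    · simp [det_fin_three]
    · simp [det_fin_three, hc₁]
    · ext i j; fin_cases i <;> fin_cases j <;> simp [hc₁]
      ring
    · simp [zero_eq_vec_three]

theorem isClassified_corner_eq_zero (r₁ r₂ c₁ c₂ d₁₁ d₁₂ d₂₁ d₂₂ : F) :
    IsClassified ![!![0, r₁, r₂; c₁, d₁₁, d₁₂; c₂, d₂₁, d₂₂],
      !![0, 0, 0; 0, 1, 0; 0, 0, 1]] := by
  -- Conjugation by `1 ⊕ S` fixes the second matrix; `S⁻¹` is written out as the adjugate divided by
  -- the determinant.
  have conj : ∀ (A : Matrix (Fin 3) (Fin 3) F) (s₁₁ s₁₂ s₂₁ s₂₂ : F),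
      s₁₁ * s₂₂ - s₁₂ * s₂₁ ≠ 0 → ∀ (t : F), t = (s₁₁ * s₂₂ - s₁₂ * s₂₁)⁻¹ →
      IsClassified ![!![1, 0, 0; 0, t * s₂₂, -t * s₁₂; 0, -t * s₂₁, t * s₁₁] * A *
        !![1, 0, 0; 0, s₁₁, s₁₂; 0, s₂₁, s₂₂], !![0, 0, 0; 0, 1, 0; 0, 0, 1]] →
      IsClassified ![A, !![0, 0, 0; 0, 1, 0; 0, 0, 1]] := by
    intro A s₁₁ s₁₂ s₂₁ s₂₂ hs t ht h
    have ht' : t * (s₁₁ * s₂₂ - s₁₂ * s₂₁) = 1 := by rw [ht, inv_mul_cancel₀ hs]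
    refine h.of_mul _ _ ?_ ?_ rfl ?_
    · have : t ≠ 0 := left_ne_zero_of_mul_eq_one ht'
      have e : t * s₂₂ * (t * s₁₁) - t * s₁₂ * (t * s₂₁) = t := by linear_combination t * ht'
      simpa [det_fin_three, e] using this
    · simpa [det_fin_three] using hs
    · ext i j; fin_cases i <;> fin_cases j <;> simp <;>
        first | ring1 | linear_combination ht'
  obtain ⟨s₁₁, s₁₂, s₂₁, s₂₂, ε, hε, hs, h1, h2⟩ := exists_row_reduction r₁ r₂
  rcases hε with rfl | rfl
  · have hr : r₁ = 0 ∧ r₂ = 0 := by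
      constructor
      · refine (mul_eq_zero.1 (?_ : (s₁₁ * s₂₂ - s₁₂ * s₂₁) * r₁ = 0)).resolve_left hs
        linear_combination s₂₂ * h1 - s₂₁ * h2
      · refine (mul_eq_zero.1 (?_ : (s₁₁ * s₂₂ - s₁₂ * s₂₁) * r₂ = 0)).resolve_left hs
        linear_combination s₁₁ * h2 - s₁₂ * h1
    obtain ⟨rfl, rfl⟩ := hr
    clear h1 h2 hs s₁₁ s₁₂ s₂₁ s₂₂
    suffices h : ∀ x y z w : F, IsClassified ![!![0, 0, 0; 1, x, y; 0, z, w],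
        !![0, 0, 0; 0, 1, 0; 0, 0, 1]] by
      by_cases hc : c₁ = 0 ∧ c₂ = 0
      · obtain ⟨rfl, rfl⟩ := hc
        exact isClassified_block 0 !![d₁₁, d₁₂; d₂₁, d₂₂]
      by_cases hc₁ : c₁ = 0
      · have hc₂ : c₂ ≠ 0 := fun hc₂ => hc ⟨hc₁, hc₂⟩
        -- The first column of `S` is `(c₁, c₂)`, so that `S⁻¹` sends this vector to the first basis
        -- vector.
        refine conj _ 0 1 c₂ 0 (by simpa using hc₂) (-c₂⁻¹) (by rw [zero_mul, one_mul, zero_sub, inv_neg]) ?_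
        convert h _ _ _ _ using 2
        ext i j; fin_cases i <;> fin_cases j
        all_goals first | rfl | simp [hc₁, hc₂]
      · refine conj _ c₁ 0 c₂ 1 (by simpa using hc₁) c₁⁻¹ (by simp) ?_
        convert h _ _ _ _ using 2
        ext i j; fin_cases i <;> fin_cases j
        all_goals first | rfl | simp [hc₁]
        field_simp
        simp
    intro x y z w
    refine IsClassified.of_equiv (.shift _ _ (-w)) ?_
    suffices h : IsClassified ![!![0, 0, 0; 1, 0, 0; 0, z, 0], !![0, 0, 0; 0, 1, 0; 0, 0, 1]] by
      refine h.of_mul 1 !![1, -(x - w), -y; 0, 1, 0; 0, 0, 1] ?_ ?_ ?_ ?_ <;>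
        simp [zero_eq_vec_three, det_fin_three]
      ring
    by_cases hz : z = 0
    · subst hz
      refine IsClassified.swap ?_
      have e : (!![0, 0, 0; 1, 0, 0; 0, 0, 0] : Matrix (Fin 3) (Fin 3) F) = vecMulVec ![0, 1, 0] ![1, 0, 0] := by
        ext i j; fin_cases i <;> fin_cases j <;> simp [vecMulVec_apply]
      rw [e]
      exact isClassified_vecMulVec _ _ _
    · refine (show IsClassified (F := F)
        ![!![0, 0, 0; 1, 0, 0; 0, 1, 0], !![0, 0, 0; 0, 1, 0; 0, 0, 1]] from
        isClassified_normalForm 17 (by decide)).of_mul !![1, 0, 0; 0, 1, 0; 0, 0, z⁻¹]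
        !![1, 0, 0; 0, 1, 0; 0, 0, z] ?_ ?_ ?_ ?_ <;>
        simp [zero_eq_vec_three, det_fin_three, hz]
  · refine conj _ s₁₁ s₁₂ s₂₁ s₂₂ hs _ rfl ?_
    generalize (s₁₁ * s₂₂ - s₁₂ * s₂₁)⁻¹ = t
    suffices h : ∀ c₁ c₂ x y z w : F, IsClassified ![!![0, 1, 0; c₁, x, y; c₂, z, w],
        !![0, 0, 0; 0, 1, 0; 0, 0, 1]] by
      convert h _ _ _ _ _ _ using 2
      ext i j; fin_cases i <;> fin_cases j
      all_goals first | rfl | simp [h1, h2]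
    intro c₁ c₂ x y z w
    refine (isClassified_cleared c₁ c₂ y w).of_mul !![1, 0, 0; -x, 1, 0; -z, 0, 1] 1 ?_ ?_ ?_ ?_ <;>
      simp [zero_eq_vec_three, det_fin_three]

/-- The first row and column of the second matrix are zero, so a nonzero corner of `A` can be used
to clear its row and column, leaving a Schur complement. The remaining case is a zero corner. -/
theorem isClassified_rank_two (A : Matrix (Fin 3) (Fin 3) F) :
    IsClassified ![A, !![0, 0, 0; 0, 1, 0; 0, 0, 1]] := by
  rw [A.eta_fin_three]
  by_cases ha : A 0 0 = 0
  · rw [ha]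
    exact isClassified_corner_eq_zero _ _ _ _ _ _ _ _
  · refine (isClassified_block (A 0 0) !![A 1 1 - A 1 0 * A 0 1 / A 0 0,
      A 1 2 - A 1 0 * A 0 2 / A 0 0; A 2 1 - A 2 0 * A 0 1 / A 0 0,
      A 2 2 - A 2 0 * A 0 2 / A 0 0]).of_mul
      !![1, 0, 0; -(A 1 0 / A 0 0), 1, 0; -(A 2 0 / A 0 0), 0, 1]
      !![1, -(A 0 1 / A 0 0), -(A 0 2 / A 0 0); 0, 1, 0; 0, 0, 1] ?_ ?_ ?_ ?_
    · simp [det_fin_three]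
    · simp [det_fin_three]
    · ext i j; fin_cases i <;> fin_cases j <;> simp <;> field_simp <;> ring
    · simp [zero_eq_vec_three]

/-- A pencil containing a singular matrix is classified. -/
theorem isClassified_of_det_eq_zero (A B : Matrix (Fin 3) (Fin 3) F) (hB : B.det = 0) :
    IsClassified ![A, B] := by
  obtain ⟨P, Q, d, hP, hQ, hd, h⟩ := exists_mul_mul_eq_diagonal B
  refine IsClassified.of_mul ?_ P Q hP hQ rfl h
  generalize P * A * Q = A
  have hdet : d 0 * d 1 * d 2 = 0 := by
    rw [← Fin.prod_univ_three, ← Matrix.det_diagonal, ← h, Matrix.det_mul, Matrix.det_mul, hB]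
    simp
  have e : diagonal d = !![d 0, 0, 0; 0, d 1, 0; 0, 0, d 2] := by
    ext i j; fin_cases i <;> fin_cases j <;> simp
  rw [e]
  clear e h
  rcases hd 0 with h0 | h0 <;> rcases hd 1 with h1 | h1 <;> rcases hd 2 with h2 | h2 <;>
    rw [h0, h1, h2] <;> rw [h0, h1, h2] at hdet
  · convert isClassified_vecMulVec A 0 0 using 2
    congr 1
    ext i j; fin_cases i <;> fin_cases j <;> simp [vecMulVec_apply]
  · convert isClassified_vecMulVec A ![0, 0, 1] ![0, 0, 1] using 2
    congr 1
    ext i j; fin_cases i <;> fin_cases j <;> simp [vecMulVec_apply]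
  · convert isClassified_vecMulVec A ![0, 1, 0] ![0, 1, 0] using 2
    congr 1
    ext i j; fin_cases i <;> fin_cases j <;> simp [vecMulVec_apply]
  · exact isClassified_rank_two A
  · exact isClassified_corner A
  · refine (isClassified_rank_two _).of_mul !![0, 1, 0; 1, 0, 0; 0, 0, 1]
      !![0, 1, 0; 1, 0, 0; 0, 0, 1] ?_ ?_ rfl ?_ <;> simp [zero_eq_vec_three, det_fin_three]
  · refine (isClassified_rank_two _).of_mul !![0, 0, 1; 0, 1, 0; 1, 0, 0]
      !![0, 0, 1; 0, 1, 0; 1, 0, 0] ?_ ?_ rfl ?_ <;> simp [zero_eq_vec_three, det_fin_three]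
  · simp at hdet

theorem isClassified_of_exists_det_eq_zero (T : Pencil F) (x : Fin 2 → F) (hx : x ≠ 0)
    (h : (x 0 • T 0 + x 1 • T 1).det = 0) : IsClassified T := by
  have hT : T = ![T 0, T 1] := by ext i : 1; fin_cases i <;> rfl
  rw [hT]
  by_cases h0 : x 0 = 0
  · have h1 : x 1 ≠ 0 := fun h1 => hx (by ext i; fin_cases i <;> simp [h0, h1])
    exact IsClassified.of_equiv (.of_comb _ _ 1 0 (x 0) (x 1) (by simpa using h1))
      (isClassified_of_det_eq_zero _ _ h)
  · exact IsClassified.of_equiv (.of_comb _ _ 0 1 (x 0) (x 1) (by simpa using h0))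
      (isClassified_of_det_eq_zero _ _ h)

/-! ### Invariants of pencils -/

/-- The member of a pencil with given parameters. -/
def Pencil.eval (T : Pencil F) (x : Fin 2 → F) : Matrix (Fin 3) (Fin 3) F :=
  x 0 • T 0 + x 1 • T 1

/-- The matrices of rank at most one. -/
def IsPure {m n : Type*} (M : Matrix m n F) : Prop := ∃ y z, M = vecMulVec y z

theorem IsPure.mul_mul {M : Matrix (Fin 3) (Fin 3) F} (h : IsPure M)
    (P Q : Matrix (Fin 3) (Fin 3) F) : IsPure (P * M * Q) := by
  obtain ⟨y, z, rfl⟩ := h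
  exact ⟨P *ᵥ y, z ᵥ* Q, by rw [Matrix.mul_vecMulVec, Matrix.vecMulVec_mul]⟩

theorem IsPure.minor_eq {m n : Type*} {M : Matrix m n F} (h : IsPure M) (i k : m) (j l : n) :
    M i j * M k l = M i l * M k j := by
  obtain ⟨y, z, rfl⟩ := h
  simp only [vecMulVec_apply]
  ring

/-- The cross product of two vectors of length two. -/
def cross (x y : Fin 2 → F) : F := x 0 * y 1 - x 1 * y 0

/-- The member of `T` at `x` is `P` times the member of `S` at `gᵀ x` times `Q`, so `e` is the
inverse of `gᵀ`. It scales cross products by a nonzero factor, so independent parameters stay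
independent. The invariance of every property below follows from this. -/
theorem PencilEquiv.exists_eval_eq {S T : Pencil F} (h : PencilEquiv S T) :
    ∃ (e : (Fin 2 → F) ≃ₗ[F] (Fin 2 → F)) (P Q : Matrix (Fin 3) (Fin 3) F),
      P.det ≠ 0 ∧ Q.det ≠ 0 ∧ (∀ x y, cross x y ≠ 0 → cross (e x) (e y) ≠ 0) ∧
      ∀ x, T.eval (e x) = P * S.eval x * Q := by
  obtain ⟨g, P, Q, hg, hP, hQ, h⟩ := h
  have h1 : (gᵀ)⁻¹ * gᵀ = 1 := Matrix.nonsing_inv_mul _ (by simpa using hg)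
  have h2 : gᵀ * (gᵀ)⁻¹ = 1 := Matrix.mul_nonsing_inv _ (by simpa using hg)
  let e := Matrix.toLin'OfInv h2 h1
  have hTS : ∀ x, T.eval x = P * S.eval (e.symm x) * Q := by
    intro x
    have he : ∀ i, e.symm x i = x 0 * g 0 i + x 1 * g 1 i := by
      intro i
      change (gᵀ *ᵥ x) i = _
      simp [Matrix.mulVec, dotProduct, Fin.sum_univ_two, mul_comm]
    simp only [Pencil.eval, h, he, Fin.sum_univ_two, Matrix.mul_add, Matrix.add_mul,
      Matrix.mul_smul, Matrix.smul_mul, smul_add, smul_smul, add_smul]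
    abel
  refine ⟨e, P, Q, hP, hQ, fun x y hxy => ?_, fun x => by rw [hTS, e.symm_apply_apply]⟩
  have he : ∀ z, e.symm z = gᵀ *ᵥ z := fun z => rfl
  have hc : cross x y = cross (e x) (e y) * g.det := by
    rw [← e.symm_apply_apply x, ← e.symm_apply_apply y, e.apply_symm_apply, e.apply_symm_apply]
    generalize e x = u
    generalize e y = v
    simp only [he, cross, Matrix.mulVec, dotProduct, Fin.sum_univ_two, Matrix.transpose_apply,
      Matrix.det_fin_two]
    ring
  intro h0
  exact hxy (by rw [hc, h0, zero_mul])

namespace Pencil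

/-- Some nonzero member vanishes. -/
def HasZero (T : Pencil F) : Prop := ∃ x, x ≠ 0 ∧ T.eval x = 0

/-- All members vanish. -/
def AllZero (T : Pencil F) : Prop := ∀ x, T.eval x = 0

/-- The members have a common vector in their left kernels. -/
def LeftDegenerate (T : Pencil F) : Prop := ∃ w, w ≠ 0 ∧ ∀ x, w ᵥ* T.eval x = 0

/-- The members have a common vector in their kernels. -/
def RightDegenerate (T : Pencil F) : Prop := ∃ v, v ≠ 0 ∧ ∀ x, T.eval x *ᵥ v = 0

/-- Some nonzero parameter gives a member of rank at most one. -/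
def HasPure (T : Pencil F) : Prop := ∃ x, x ≠ 0 ∧ IsPure (T.eval x)

/-- Two independent parameters give members of rank at most one. -/
def HasTwoPure (T : Pencil F) : Prop :=
  ∃ x y, cross x y ≠ 0 ∧ IsPure (T.eval x) ∧ IsPure (T.eval y)

/-- All members have rank at most one. -/
def AllPure (T : Pencil F) : Prop := ∀ x, IsPure (T.eval x)

/-- All members have their columns in a common line. -/
def CommonColumn (T : Pencil F) : Prop := ∃ y, ∀ x, ∃ z, T.eval x = vecMulVec y z

/-- All members are singular. -/
def AllSingular (T : Pencil F) : Prop := ∀ x, (T.eval x).det = 0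

/-- Two independent parameters give singular members. -/
def HasTwoSingular (T : Pencil F) : Prop :=
  ∃ x y, cross x y ≠ 0 ∧ (T.eval x).det = 0 ∧ (T.eval y).det = 0

/-- Three pairwise independent parameters give singular members. -/
def HasThreeSingular (T : Pencil F) : Prop :=
  ∃ x y z, cross x y ≠ 0 ∧ cross y z ≠ 0 ∧ cross x z ≠ 0 ∧
    (T.eval x).det = 0 ∧ (T.eval y).det = 0 ∧ (T.eval z).det = 0

/-- Some singular member is a multiple zero of the determinant. -/
def HasDoubleZero (T : Pencil F) : Prop :=
  -- At a matrix of rank two with kernel vectors `v` and `w`, the derivative of the determinant in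
  -- the direction `N` is a nonzero multiple of `w ⬝ᵥ (N *ᵥ v)`.
  ∃ x v w, x ≠ 0 ∧ v ≠ 0 ∧ w ≠ 0 ∧ T.eval x *ᵥ v = 0 ∧ w ᵥ* T.eval x = 0 ∧
    ∀ y, w ⬝ᵥ (T.eval y *ᵥ v) = 0

variable {S T : Pencil F}

theorem HasZero.of_equiv (h : PencilEquiv S T) (hS : S.HasZero) : T.HasZero := by
  obtain ⟨e, P, Q, hP, hQ, hc, h⟩ := h.exists_eval_eq
  obtain ⟨x, hx, h0⟩ := hS
  exact ⟨e x, by simpa using hx, by simp [h, h0]⟩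

theorem AllZero.of_equiv (h : PencilEquiv S T) (hS : S.AllZero) : T.AllZero := by
  obtain ⟨e, P, Q, hP, hQ, hc, h⟩ := h.exists_eval_eq
  intro x
  obtain ⟨x, rfl⟩ := e.surjective x
  simp [h, hS x]

theorem LeftDegenerate.of_equiv (h : PencilEquiv S T) (hS : S.LeftDegenerate) :
    T.LeftDegenerate := by
  obtain ⟨e, P, Q, hP, hQ, hc, h⟩ := h.exists_eval_eq
  obtain ⟨w, hw, h0⟩ := hS
  have hw' : w = (w ᵥ* P⁻¹) ᵥ* P := by
    rw [Matrix.vecMul_vecMul, Matrix.nonsing_inv_mul _ hP.isUnit, Matrix.vecMul_one]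
  refine ⟨w ᵥ* P⁻¹, fun h => hw (by rw [hw', h, Matrix.zero_vecMul]), fun x => ?_⟩
  obtain ⟨x, rfl⟩ := e.surjective x
  rw [h, ← Matrix.vecMul_vecMul, ← Matrix.vecMul_vecMul, ← hw', h0, Matrix.zero_vecMul]

theorem RightDegenerate.of_equiv (h : PencilEquiv S T) (hS : S.RightDegenerate) :
    T.RightDegenerate := by
  obtain ⟨e, P, Q, hP, hQ, hc, h⟩ := h.exists_eval_eq
  obtain ⟨v, hv, h0⟩ := hS
  have hv' : v = Q *ᵥ (Q⁻¹ *ᵥ v) := by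
    rw [Matrix.mulVec_mulVec, Matrix.mul_nonsing_inv _ hQ.isUnit, Matrix.one_mulVec]
  refine ⟨Q⁻¹ *ᵥ v, fun h => hv (by rw [hv', h, Matrix.mulVec_zero]), fun x => ?_⟩
  obtain ⟨x, rfl⟩ := e.surjective x
  rw [h, ← Matrix.mulVec_mulVec, ← Matrix.mulVec_mulVec, ← hv', h0, Matrix.mulVec_zero]

theorem HasPure.of_equiv (h : PencilEquiv S T) (hS : S.HasPure) : T.HasPure := by
  obtain ⟨e, P, Q, hP, hQ, hc, h⟩ := h.exists_eval_eq
  obtain ⟨x, hx, h0⟩ := hS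
  exact ⟨e x, by simpa using hx, by rw [h]; exact h0.mul_mul P Q⟩

theorem HasTwoPure.of_equiv (h : PencilEquiv S T) (hS : S.HasTwoPure) : T.HasTwoPure := by
  obtain ⟨e, P, Q, hP, hQ, hc, h⟩ := h.exists_eval_eq
  obtain ⟨x, y, hxy, hx, hy⟩ := hS
  exact ⟨e x, e y, hc _ _ hxy, by rw [h]; exact hx.mul_mul P Q, by rw [h]; exact hy.mul_mul P Q⟩

theorem AllPure.of_equiv (h : PencilEquiv S T) (hS : S.AllPure) : T.AllPure := by
  obtain ⟨e, P, Q, hP, hQ, hc, h⟩ := h.exists_eval_eq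
  intro x
  obtain ⟨x, rfl⟩ := e.surjective x
  rw [h]
  exact (hS x).mul_mul P Q

theorem CommonColumn.of_equiv (h : PencilEquiv S T) (hS : S.CommonColumn) :
    T.CommonColumn := by
  obtain ⟨e, P, Q, hP, hQ, hc, h⟩ := h.exists_eval_eq
  obtain ⟨y, hy⟩ := hS
  refine ⟨P *ᵥ y, fun x => ?_⟩
  obtain ⟨x, rfl⟩ := e.surjective x
  obtain ⟨z, hz⟩ := hy x
  exact ⟨z ᵥ* Q, by rw [h, hz, Matrix.mul_vecMulVec, Matrix.vecMulVec_mul]⟩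

theorem AllSingular.of_equiv (h : PencilEquiv S T) (hS : S.AllSingular) : T.AllSingular := by
  obtain ⟨e, P, Q, hP, hQ, hc, h⟩ := h.exists_eval_eq
  intro x
  obtain ⟨x, rfl⟩ := e.surjective x
  simp [h, hS x]

theorem HasTwoSingular.of_equiv (h : PencilEquiv S T) (hS : S.HasTwoSingular) :
    T.HasTwoSingular := by
  obtain ⟨e, P, Q, hP, hQ, hc, h⟩ := h.exists_eval_eq
  obtain ⟨x, y, hxy, hx, hy⟩ := hS
  exact ⟨e x, e y, hc _ _ hxy, by simp [h, hx], by simp [h, hy]⟩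

theorem HasThreeSingular.of_equiv (h : PencilEquiv S T) (hS : S.HasThreeSingular) :
    T.HasThreeSingular := by
  obtain ⟨e, P, Q, hP, hQ, hc, h⟩ := h.exists_eval_eq
  obtain ⟨x, y, z, hxy, hyz, hxz, hx, hy, hz⟩ := hS
  exact ⟨e x, e y, e z, hc _ _ hxy, hc _ _ hyz, hc _ _ hxz, by simp [h, hx], by simp [h, hy],
    by simp [h, hz]⟩

theorem HasDoubleZero.of_equiv (h : PencilEquiv S T) (hS : S.HasDoubleZero) :
    T.HasDoubleZero := by
  obtain ⟨e, P, Q, hP, hQ, hc, h⟩ := h.exists_eval_eq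
  obtain ⟨x, v, w, hx, hv, hw, hxv, hwx, hy⟩ := hS
  have hv' : v = Q *ᵥ (Q⁻¹ *ᵥ v) := by
    rw [Matrix.mulVec_mulVec, Matrix.mul_nonsing_inv _ hQ.isUnit, Matrix.one_mulVec]
  have hw' : w = (w ᵥ* P⁻¹) ᵥ* P := by
    rw [Matrix.vecMul_vecMul, Matrix.nonsing_inv_mul _ hP.isUnit, Matrix.vecMul_one]
  refine ⟨e x, Q⁻¹ *ᵥ v, w ᵥ* P⁻¹, by simpa using hx,
    fun h => hv (by rw [hv', h, Matrix.mulVec_zero]),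
    fun h => hw (by rw [hw', h, Matrix.zero_vecMul]), ?_, ?_, fun y => ?_⟩
  · rw [h, ← Matrix.mulVec_mulVec, ← Matrix.mulVec_mulVec, ← hv', hxv, Matrix.mulVec_zero]
  · rw [h, ← Matrix.vecMul_vecMul, ← Matrix.vecMul_vecMul, ← hw', hwx, Matrix.zero_vecMul]
  · obtain ⟨y, rfl⟩ := e.surjective y
    rw [h, ← Matrix.mulVec_mulVec, ← hv', ← Matrix.mulVec_mulVec, Matrix.dotProduct_mulVec, ← hw',
      hy]

open Classical in
/-- The index of the normal form of a pencil, as a function of invariants. -/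
noncomputable def index (T : Pencil F) : ℕ :=
  -- Every test is invariant under equivalence, so any decision tree would do; this one separates
  -- the twenty forms. Final branches such as 18 and 19 also receive pencils outside the list, which
  -- is harmless.
  if T.HasZero then
    if T.AllZero then 0 else if T.AllPure then 1 else if T.LeftDegenerate then 2 else 3
  else if T.LeftDegenerate then
    if T.RightDegenerate then
      if T.AllPure then
        if T.CommonColumn then 4 else 15
      else if T.HasTwoPure then 6 else if T.HasPure then 5 else 18
    else if T.HasPure then 7 else 17
  else if T.RightDegenerate then
    if T.HasPure then 16 else 8
  else if T.AllSingular then 9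
  else if T.HasPure then
    if T.HasTwoSingular then 13 else 11
  else if T.HasThreeSingular then 14
  else if T.HasTwoSingular then 12
  else if T.HasDoubleZero then 10 else 19

theorem index_eq_of_equiv (h : PencilEquiv S T) : S.index = T.index := by
  have h1 : S.HasZero = T.HasZero := propext ⟨.of_equiv h, .of_equiv h.symm⟩
  have h2 : S.AllZero = T.AllZero := propext ⟨.of_equiv h, .of_equiv h.symm⟩
  have h3 : S.LeftDegenerate = T.LeftDegenerate := propext ⟨.of_equiv h, .of_equiv h.symm⟩
  have h4 : S.RightDegenerate = T.RightDegenerate := propext ⟨.of_equiv h, .of_equiv h.symm⟩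
  have h5 : S.HasPure = T.HasPure := propext ⟨.of_equiv h, .of_equiv h.symm⟩
  have h6 : S.HasTwoPure = T.HasTwoPure := propext ⟨.of_equiv h, .of_equiv h.symm⟩
  have h7 : S.AllPure = T.AllPure := propext ⟨.of_equiv h, .of_equiv h.symm⟩
  have h8 : S.CommonColumn = T.CommonColumn := propext ⟨.of_equiv h, .of_equiv h.symm⟩
  have h9 : S.AllSingular = T.AllSingular := propext ⟨.of_equiv h, .of_equiv h.symm⟩
  have h10 : S.HasTwoSingular = T.HasTwoSingular := propext ⟨.of_equiv h, .of_equiv h.symm⟩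
  have h11 : S.HasThreeSingular = T.HasThreeSingular := propext ⟨.of_equiv h, .of_equiv h.symm⟩
  have h12 : S.HasDoubleZero = T.HasDoubleZero := propext ⟨.of_equiv h, .of_equiv h.symm⟩
  unfold index
  rw [h1, h2, h3, h4, h5, h6, h7, h8, h9, h10, h11, h12]

end Pencil

/-! ### Values of the invariants on the normal forms -/

theorem fin_three_eq_zero_iff {a b c d e f g h i : F} :
    !![a, b, c; d, e, f; g, h, i] = 0 ↔
      (a = 0 ∧ b = 0 ∧ c = 0) ∧ (d = 0 ∧ e = 0 ∧ f = 0) ∧ g = 0 ∧ h = 0 ∧ i = 0 := by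
  rw [← Matrix.ext_iff]
  simp [Fin.forall_fin_succ]

theorem vecMul_fin_three_eq_zero_iff {w : Fin 3 → F} {a b c d e f g h i : F} :
    w ᵥ* !![a, b, c; d, e, f; g, h, i] = 0 ↔ w 0 * a + w 1 * d + w 2 * g = 0 ∧
      w 0 * b + w 1 * e + w 2 * h = 0 ∧ w 0 * c + w 1 * f + w 2 * i = 0 := by
  rw [funext_iff]
  simp [Matrix.vecMul, dotProduct, Fin.sum_univ_three, Fin.forall_fin_succ]

theorem fin_three_mulVec_eq_zero_iff {v : Fin 3 → F} {a b c d e f g h i : F} :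
    !![a, b, c; d, e, f; g, h, i] *ᵥ v = 0 ↔ a * v 0 + b * v 1 + c * v 2 = 0 ∧
      d * v 0 + e * v 1 + f * v 2 = 0 ∧ g * v 0 + h * v 1 + i * v 2 = 0 := by
  rw [funext_iff]
  simp [Matrix.mulVec, dotProduct, Fin.sum_univ_three, Fin.forall_fin_succ]

namespace Pencil

theorem eval_fin_three (a b c d e f g h i a' b' c' d' e' f' g' h' i' : F) (x : Fin 2 → F) :
    Pencil.eval ![!![a, b, c; d, e, f; g, h, i], !![a', b', c'; d', e', f'; g', h', i']] x =
      !![x 0 * a + x 1 * a', x 0 * b + x 1 * b', x 0 * c + x 1 * c';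
        x 0 * d + x 1 * d', x 0 * e + x 1 * e', x 0 * f + x 1 * f';
        x 0 * g + x 1 * g', x 0 * h + x 1 * h', x 0 * i + x 1 * i'] := by
  ext j k
  fin_cases j <;> fin_cases k <;> simp [Pencil.eval]

variable {T : Pencil F}

theorem not_hasZero (h : ∀ x, T.eval x = 0 → x 0 = 0 ∧ x 1 = 0) : ¬ T.HasZero := by
  rintro ⟨x, hx, h0⟩
  exact hx (by ext i; fin_cases i <;> simp [h x h0])

theorem not_hasPure (h : ∀ x, IsPure (T.eval x) → x 0 = 0 ∧ x 1 = 0) : ¬ T.HasPure := by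
  rintro ⟨x, hx, h0⟩
  exact hx (by ext i; fin_cases i <;> simp [h x h0])

theorem not_leftDegenerate (h : ∀ w, w ᵥ* T.eval ![1, 0] = 0 → w ᵥ* T.eval ![0, 1] = 0 →
    w 0 = 0 ∧ w 1 = 0 ∧ w 2 = 0) : ¬ T.LeftDegenerate := by
  rintro ⟨w, hw, h0⟩
  exact hw (by ext i; fin_cases i <;> simp [h w (h0 _) (h0 _)])

theorem not_rightDegenerate (h : ∀ v, T.eval ![1, 0] *ᵥ v = 0 → T.eval ![0, 1] *ᵥ v = 0 →
    v 0 = 0 ∧ v 1 = 0 ∧ v 2 = 0) : ¬ T.RightDegenerate := by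
  rintro ⟨w, hw, h0⟩
  exact hw (by ext i; fin_cases i <;> simp [h w (h0 _) (h0 _)])

theorem not_hasTwoSingular (h : ∀ x, (T.eval x).det = 0 → x 0 = 0) : ¬ T.HasTwoSingular := by
  rintro ⟨x, y, hxy, hx, hy⟩
  exact hxy (by simp [cross, h x hx, h y hy])

/-- Of three parameters on the two axes, two lie on the same axis and so are dependent. -/
theorem not_hasThreeSingular (h : ∀ x, (T.eval x).det = 0 → x 0 = 0 ∨ x 1 = 0) :
    ¬ T.HasThreeSingular := by
  rintro ⟨x, y, z, hxy, hyz, hxz, hx, hy, hz⟩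
  rcases h x hx with hx | hx <;> rcases h y hy with hy | hy <;> rcases h z hz with hz | hz <;>
    simp [cross, hx, hy, hz] at hxy hyz hxz

theorem leftDegenerate_of_row (i : Fin 3) (h : ∀ x j, T.eval x i j = 0) : T.LeftDegenerate :=
  ⟨Pi.single i 1, by simp, fun x => by ext j; simp [h]⟩

theorem rightDegenerate_of_col (j : Fin 3) (h : ∀ x i, T.eval x i j = 0) : T.RightDegenerate :=
  ⟨Pi.single j 1, by simp, fun x => by ext i; simp [h]⟩

theorem index_zero : Pencil.index (![0, 0] : Pencil F) = 0 := by
  have e : ∀ x, Pencil.eval (![0, 0] : Pencil F) x = 0 := fun x => by simp [eval]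
  have h1 : HasZero (![0, 0] : Pencil F) := ⟨![1, 0], by simp, e _⟩
  have h2 : AllZero (![0, 0] : Pencil F) := e
  simp [index, h1, h2]

theorem hasZero_pair (A : Matrix (Fin 3) (Fin 3) F) : HasZero ![A, 0] :=
  ⟨![0, 1], by simp, by simp [eval]⟩

theorem index_one : Pencil.index (![!![1, 0, 0; 0, 0, 0; 0, 0, 0], 0] : Pencil F) = 1 := by
  set T : Pencil F := ![!![1, 0, 0; 0, 0, 0; 0, 0, 0], 0] with hT
  have e : ∀ x, T.eval x = x 0 • !![1, 0, 0; 0, 0, 0; 0, 0, 0] := fun x => by simp [eval, hT]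
  have h1 : T.HasZero := hasZero_pair _
  have h2 : ¬ T.AllZero := fun h => by
    have := congrFun (congrFun (h ![1, 0]) 0) 0
    simp [e] at this
  have h3 : T.AllPure := fun x => ⟨![x 0, 0, 0], ![1, 0, 0], by
    rw [e]; ext i j; fin_cases i <;> fin_cases j <;> simp [vecMulVec_apply]⟩
  simp [index, h1, h2, h3]

theorem index_two : Pencil.index (![!![0, 0, 0; 0, 1, 0; 0, 0, 1], 0] : Pencil F) = 2 := by
  set T : Pencil F := ![!![0, 0, 0; 0, 1, 0; 0, 0, 1], 0] with hT
  have e : ∀ x, T.eval x = x 0 • !![0, 0, 0; 0, 1, 0; 0, 0, 1] := fun x => by simp [eval, hT]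
  have h1 : T.HasZero := hasZero_pair _
  have h2 : ¬ T.AllZero := fun h => by
    have := congrFun (congrFun (h ![1, 0]) 1) 1
    simp [e] at this
  have h3 : ¬ T.AllPure := fun h => by
    have := (h ![1, 0]).minor_eq 1 2 1 2
    simp [e] at this
  have h4 : T.LeftDegenerate := leftDegenerate_of_row 0 fun x j => by
    rw [e]; fin_cases j <;> simp
  simp [index, h1, h2, h3, h4]

theorem index_three : Pencil.index (![!![1, 0, 0; 0, 1, 0; 0, 0, 1], 0] : Pencil F) = 3 := by
  set T : Pencil F := ![!![1, 0, 0; 0, 1, 0; 0, 0, 1], 0] with hT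
  have e : ∀ x, T.eval x = x 0 • !![1, 0, 0; 0, 1, 0; 0, 0, 1] := fun x => by simp [eval, hT]
  have h1 : T.HasZero := hasZero_pair _
  have h2 : ¬ T.AllZero := fun h => by
    have := congrFun (congrFun (h ![1, 0]) 1) 1
    simp [e] at this
  have h3 : ¬ T.AllPure := fun h => by
    have := (h ![1, 0]).minor_eq 1 2 1 2
    simp [e] at this
  have h4 : ¬ T.LeftDegenerate := not_leftDegenerate fun w hw _ => by
    rw [e, Matrix.cons_val_zero, one_smul, vecMul_fin_three_eq_zero_iff] at hw
    simpa using hw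
  simp [index, h1, h2, h3, h4]

theorem index_four : Pencil.index
    (![!![0, 1, 0; 0, 0, 0; 0, 0, 0], !![1, 0, 0; 0, 0, 0; 0, 0, 0]] : Pencil F) = 4 := by
  set T : Pencil F := ![!![0, 1, 0; 0, 0, 0; 0, 0, 0], !![1, 0, 0; 0, 0, 0; 0, 0, 0]] with hT
  have e : ∀ x, T.eval x = !![x 1, x 0, 0; 0, 0, 0; 0, 0, 0] := fun x => by
    rw [hT, eval_fin_three]; simp
  have h1 : ¬ T.HasZero := not_hasZero fun x h => by
    simp [e, fin_three_eq_zero_iff] at h; simp [h]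
  have h2 : T.LeftDegenerate := leftDegenerate_of_row 2 fun x j => by
    rw [e]; fin_cases j <;> simp
  have h3 : T.RightDegenerate := rightDegenerate_of_col 2 fun x j => by
    rw [e]; fin_cases j <;> simp
  have h4 : ∀ x, T.eval x = vecMulVec ![1, 0, 0] ![x 1, x 0, 0] := fun x => by
    rw [e]; ext i j; fin_cases i <;> fin_cases j <;> simp [vecMulVec_apply]
  have h5 : T.AllPure := fun x => ⟨_, _, h4 x⟩
  have h6 : T.CommonColumn := ⟨_, fun x => ⟨_, h4 x⟩⟩
  simp [index, h1, h2, h3, h5, h6]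

theorem index_five : Pencil.index
    (![!![0, 1, 0; 1, 0, 0; 0, 0, 0], !![1, 0, 0; 0, 0, 0; 0, 0, 0]] : Pencil F) = 5 := by
  set T : Pencil F := ![!![0, 1, 0; 1, 0, 0; 0, 0, 0], !![1, 0, 0; 0, 0, 0; 0, 0, 0]] with hT
  have e : ∀ x, T.eval x = !![x 1, x 0, 0; x 0, 0, 0; 0, 0, 0] := fun x => by
    rw [hT, eval_fin_three]; simp
  have h1 : ¬ T.HasZero := not_hasZero fun x h => by
    simp [e, fin_three_eq_zero_iff] at h; simp [h]
  have h2 : T.LeftDegenerate := leftDegenerate_of_row 2 fun x j => by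
    rw [e]; fin_cases j <;> simp
  have h3 : T.RightDegenerate := rightDegenerate_of_col 2 fun x j => by
    rw [e]; fin_cases j <;> simp
  have hp : ∀ x, IsPure (T.eval x) → x 0 = 0 := fun x h => by
    simpa [e] using h.minor_eq 0 1 0 1
  have h4 : ¬ T.AllPure := fun h => by simpa using hp _ (h ![1, 0])
  have h5 : ¬ T.HasTwoPure := by
    rintro ⟨x, y, hxy, hx, hy⟩
    simp [cross, hp x hx, hp y hy] at hxy
  have h6 : T.HasPure := ⟨![0, 1], by simp, ![1, 0, 0], ![1, 0, 0], by
    rw [e]; ext i j; fin_cases i <;> fin_cases j <;> simp [vecMulVec_apply]⟩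
  simp [index, h1, h2, h3, h4, h5, h6]

theorem index_six : Pencil.index
    (![!![0, 0, 0; 0, 0, 0; 0, 0, 1], !![1, 0, 0; 0, 0, 0; 0, 0, 0]] : Pencil F) = 6 := by
  set T : Pencil F := ![!![0, 0, 0; 0, 0, 0; 0, 0, 1], !![1, 0, 0; 0, 0, 0; 0, 0, 0]] with hT
  have e : ∀ x, T.eval x = !![x 1, 0, 0; 0, 0, 0; 0, 0, x 0] := fun x => by
    rw [hT, eval_fin_three]; simp
  have h1 : ¬ T.HasZero := not_hasZero fun x h => by
    simp [e, fin_three_eq_zero_iff] at h; simp [h]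
  have h2 : T.LeftDegenerate := leftDegenerate_of_row 1 fun x j => by
    rw [e]; fin_cases j <;> simp
  have h3 : T.RightDegenerate := rightDegenerate_of_col 1 fun x j => by
    rw [e]; fin_cases j <;> simp
  have h4 : ¬ T.AllPure := fun h => by simpa [e] using (h ![1, 1]).minor_eq 0 2 0 2
  have h5 : T.HasTwoPure := ⟨![1, 0], ![0, 1], by simp [cross], ⟨![0, 0, 1], ![0, 0, 1], by
    rw [e]; ext i j; fin_cases i <;> fin_cases j <;> simp [vecMulVec_apply]⟩,
    ⟨![1, 0, 0], ![1, 0, 0], by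
      rw [e]; ext i j; fin_cases i <;> fin_cases j <;> simp [vecMulVec_apply]⟩⟩
  simp [index, h1, h2, h3, h4, h5]

theorem index_seven : Pencil.index
    (![!![0, 1, 0; 0, 0, 0; 0, 0, 1], !![1, 0, 0; 0, 0, 0; 0, 0, 0]] : Pencil F) = 7 := by
  set T : Pencil F := ![!![0, 1, 0; 0, 0, 0; 0, 0, 1], !![1, 0, 0; 0, 0, 0; 0, 0, 0]] with hT
  have e : ∀ x, T.eval x = !![x 1, x 0, 0; 0, 0, 0; 0, 0, x 0] := fun x => by
    rw [hT, eval_fin_three]; simp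
  have h1 : ¬ T.HasZero := not_hasZero fun x h => by
    simp [e, fin_three_eq_zero_iff] at h; simp [h]
  have h2 : T.LeftDegenerate := leftDegenerate_of_row 1 fun x j => by
    rw [e]; fin_cases j <;> simp
  have h3 : ¬ T.RightDegenerate := not_rightDegenerate fun v h h' => by
    rw [e, fin_three_mulVec_eq_zero_iff] at h h'; simp at h h'; simp [h, h']
  have h6 : T.HasPure := ⟨![0, 1], by simp, ![1, 0, 0], ![1, 0, 0], by
    rw [e]; ext i j; fin_cases i <;> fin_cases j <;> simp [vecMulVec_apply]⟩
  simp [index, h1, h2, h3, h6]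

theorem index_eight : Pencil.index
    (![!![0, 1, 0; 0, 0, 1; 0, 0, 0], !![0, 0, 0; 0, 1, 0; 0, 0, 1]] : Pencil F) = 8 := by
  set T : Pencil F := ![!![0, 1, 0; 0, 0, 1; 0, 0, 0], !![0, 0, 0; 0, 1, 0; 0, 0, 1]] with hT
  have e : ∀ x, T.eval x = !![0, x 0, 0; 0, x 1, x 0; 0, 0, x 1] := fun x => by
    rw [hT, eval_fin_three]; simp
  have h1 : ¬ T.HasZero := not_hasZero fun x h => by
    simp [e, fin_three_eq_zero_iff] at h; simp [h]
  have h2 : ¬ T.LeftDegenerate := not_leftDegenerate fun w h h' => by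
    rw [e, vecMul_fin_three_eq_zero_iff] at h h'; simp at h h'; simp [h, h']
  have h3 : T.RightDegenerate := rightDegenerate_of_col 0 fun x j => by
    rw [e]; fin_cases j <;> simp
  have h4 : ¬ T.HasPure := not_hasPure fun x h =>
    ⟨by simpa [e] using h.minor_eq 0 1 1 2, by simpa [e] using h.minor_eq 1 2 1 2⟩
  simp [index, h1, h2, h3, h4]

theorem index_nine : Pencil.index
    (![!![0, 0, 1; 0, 0, 0; 1, 0, 0], !![0, 0, 0; 0, 0, 1; 0, 1, 0]] : Pencil F) = 9 := by
  set T : Pencil F := ![!![0, 0, 1; 0, 0, 0; 1, 0, 0], !![0, 0, 0; 0, 0, 1; 0, 1, 0]] with hT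
  have e : ∀ x, T.eval x = !![0, 0, x 0; 0, 0, x 1; x 0, x 1, 0] := fun x => by
    rw [hT, eval_fin_three]; simp
  have h1 : ¬ T.HasZero := not_hasZero fun x h => by
    simp [e, fin_three_eq_zero_iff] at h; simp [h]
  have h2 : ¬ T.LeftDegenerate := not_leftDegenerate fun w h h' => by
    rw [e, vecMul_fin_three_eq_zero_iff] at h h'; simp at h h'; simp [h, h']
  have h3 : ¬ T.RightDegenerate := not_rightDegenerate fun v h h' => by
    rw [e, fin_three_mulVec_eq_zero_iff] at h h'; simp at h h'; simp [h, h']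
  have h4 : T.AllSingular := fun x => by rw [e]; simp [det_fin_three]
  simp [index, h1, h2, h3, h4]

theorem index_ten : Pencil.index
    (![!![0, 0, 1; 0, 1, 0; 1, 0, 0], !![0, 0, 0; 0, 0, 1; 0, 1, 0]] : Pencil F) = 10 := by
  set T : Pencil F := ![!![0, 0, 1; 0, 1, 0; 1, 0, 0], !![0, 0, 0; 0, 0, 1; 0, 1, 0]] with hT
  have e : ∀ x, T.eval x = !![0, 0, x 0; 0, x 0, x 1; x 0, x 1, 0] := fun x => by
    rw [hT, eval_fin_three]; simp
  have h1 : ¬ T.HasZero := not_hasZero fun x h => by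
    simp [e, fin_three_eq_zero_iff] at h; simp [h]
  have h2 : ¬ T.LeftDegenerate := not_leftDegenerate fun w h h' => by
    rw [e, vecMul_fin_three_eq_zero_iff] at h h'; simp at h h'; simp [h]
  have h3 : ¬ T.RightDegenerate := not_rightDegenerate fun v h h' => by
    rw [e, fin_three_mulVec_eq_zero_iff] at h h'; simp at h h'; simp [h]
  have h4 : ¬ T.AllSingular := fun h => by simpa [e, det_fin_three] using h ![1, 0]
  have h5 : ¬ T.HasPure := not_hasPure fun x h =>
    ⟨by simpa [e] using h.minor_eq 0 1 1 2, by simpa [e] using h.minor_eq 1 2 1 2⟩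
  have hd : ∀ x, (T.eval x).det = 0 → x 0 = 0 := fun x h => by simpa [e, det_fin_three] using h
  have h6 : ¬ T.HasThreeSingular := not_hasThreeSingular fun x h => Or.inl (hd x h)
  have h7 : ¬ T.HasTwoSingular := not_hasTwoSingular hd
  have h8 : T.HasDoubleZero := by
    refine ⟨![0, 1], Pi.single 0 1, Pi.single 0 1, by simp, by simp, by simp, ?_, ?_, fun y => ?_⟩
    · ext i; fin_cases i <;> simp [e]
    · ext i; fin_cases i <;> simp [e]
    · simp [e]
  simp [index, h1, h2, h3, h4, h5, h6, h7, h8]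

theorem index_eleven : Pencil.index
    (![!![0, 1, 0; 1, 0, 0; 0, 0, 1], !![1, 0, 0; 0, 0, 0; 0, 0, 0]] : Pencil F) = 11 := by
  set T : Pencil F := ![!![0, 1, 0; 1, 0, 0; 0, 0, 1], !![1, 0, 0; 0, 0, 0; 0, 0, 0]] with hT
  have e : ∀ x, T.eval x = !![x 1, x 0, 0; x 0, 0, 0; 0, 0, x 0] := fun x => by
    rw [hT, eval_fin_three]; simp
  have h1 : ¬ T.HasZero := not_hasZero fun x h => by
    simp [e, fin_three_eq_zero_iff] at h; simp [h]
  have h2 : ¬ T.LeftDegenerate := not_leftDegenerate fun w h h' => by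
    rw [e, vecMul_fin_three_eq_zero_iff] at h h'; simp at h h'; simp [h]
  have h3 : ¬ T.RightDegenerate := not_rightDegenerate fun v h h' => by
    rw [e, fin_three_mulVec_eq_zero_iff] at h h'; simp at h h'; simp [h]
  have h4 : ¬ T.AllSingular := fun h => by simpa [e, det_fin_three] using h ![1, 0]
  have h5 : T.HasPure := ⟨![0, 1], by simp, ![1, 0, 0], ![1, 0, 0], by
    rw [e]; ext i j; fin_cases i <;> fin_cases j <;> simp [vecMulVec_apply]⟩
  have h6 : ¬ T.HasTwoSingular := not_hasTwoSingular fun x h => by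
    simpa [e, det_fin_three] using h
  simp [index, h1, h2, h3, h4, h5, h6]

theorem index_twelve : Pencil.index
    (![!![0, 1, 0; 1, 0, 0; 0, 0, 0], !![0, 0, 0; 0, 1, 0; 0, 0, 1]] : Pencil F) = 12 := by
  set T : Pencil F := ![!![0, 1, 0; 1, 0, 0; 0, 0, 0], !![0, 0, 0; 0, 1, 0; 0, 0, 1]] with hT
  have e : ∀ x, T.eval x = !![0, x 0, 0; x 0, x 1, 0; 0, 0, x 1] := fun x => by
    rw [hT, eval_fin_three]; simp
  have h1 : ¬ T.HasZero := not_hasZero fun x h => by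
    simp [e, fin_three_eq_zero_iff] at h; simp [h]
  have h2 : ¬ T.LeftDegenerate := not_leftDegenerate fun w h h' => by
    rw [e, vecMul_fin_three_eq_zero_iff] at h h'; simp at h h'; simp [h, h']
  have h3 : ¬ T.RightDegenerate := not_rightDegenerate fun v h h' => by
    rw [e, fin_three_mulVec_eq_zero_iff] at h h'; simp at h h'; simp [h, h']
  have h4 : ¬ T.AllSingular := fun h => by simpa [e, det_fin_three] using h ![1, 1]
  have h5 : ¬ T.HasPure := not_hasPure fun x h =>
    ⟨by simpa [e] using h.minor_eq 0 1 0 1, by simpa [e] using h.minor_eq 1 2 1 2⟩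
  have h6 : ¬ T.HasThreeSingular := not_hasThreeSingular fun x h => by
    simpa [e, det_fin_three] using h
  have h7 : T.HasTwoSingular := ⟨![1, 0], ![0, 1], by simp [cross], by simp [e, det_fin_three],
    by simp [e, det_fin_three]⟩
  simp [index, h1, h2, h3, h4, h5, h6, h7]

theorem index_thirteen : Pencil.index
    (![!![0, 0, 0; 0, 1, 0; 0, 0, 1], !![1, 0, 0; 0, 0, 0; 0, 0, 0]] : Pencil F) = 13 := by
  set T : Pencil F := ![!![0, 0, 0; 0, 1, 0; 0, 0, 1], !![1, 0, 0; 0, 0, 0; 0, 0, 0]] with hT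
  have e : ∀ x, T.eval x = !![x 1, 0, 0; 0, x 0, 0; 0, 0, x 0] := fun x => by
    rw [hT, eval_fin_three]; simp
  have h1 : ¬ T.HasZero := not_hasZero fun x h => by
    simp [e, fin_three_eq_zero_iff] at h; simp [h]
  have h2 : ¬ T.LeftDegenerate := not_leftDegenerate fun w h h' => by
    rw [e, vecMul_fin_three_eq_zero_iff] at h h'; simp at h h'; simp [h, h']
  have h3 : ¬ T.RightDegenerate := not_rightDegenerate fun v h h' => by
    rw [e, fin_three_mulVec_eq_zero_iff] at h h'; simp at h h'; simp [h, h']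
  have h4 : ¬ T.AllSingular := fun h => by simpa [e, det_fin_three] using h ![1, 1]
  have h5 : T.HasPure := ⟨![0, 1], by simp, ![1, 0, 0], ![1, 0, 0], by
    rw [e]; ext i j; fin_cases i <;> fin_cases j <;> simp [vecMulVec_apply]⟩
  have h6 : T.HasTwoSingular := ⟨![1, 0], ![0, 1], by simp [cross], by simp [e, det_fin_three],
    by simp [e, det_fin_three]⟩
  simp [index, h1, h2, h3, h4, h5, h6]

/-- The determinant is `x₀ x₁ (x₀ + x₁)`. The hypothesis fails only for the field with two elements,
over which this cubic form vanishes at every point. -/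
theorem index_fourteen (hF : ∃ t : F, t ≠ 0 ∧ 1 + t ≠ 0) : Pencil.index
    (![!![1, 0, 0; 0, 0, 0; 0, 0, 1], !![0, 0, 0; 0, 1, 0; 0, 0, 1]] : Pencil F) = 14 := by
  set T : Pencil F := ![!![1, 0, 0; 0, 0, 0; 0, 0, 1], !![0, 0, 0; 0, 1, 0; 0, 0, 1]] with hT
  have e : ∀ x, T.eval x = !![x 0, 0, 0; 0, x 1, 0; 0, 0, x 0 + x 1] := fun x => by
    rw [hT, eval_fin_three]; simp
  have h1 : ¬ T.HasZero := not_hasZero fun x h => by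
    simp [e, fin_three_eq_zero_iff] at h; simp [h]
  have h2 : ¬ T.LeftDegenerate := not_leftDegenerate fun w h h' => by
    rw [e, vecMul_fin_three_eq_zero_iff] at h h'; simp at h h'; simp [h, h']
  have h3 : ¬ T.RightDegenerate := not_rightDegenerate fun v h h' => by
    rw [e, fin_three_mulVec_eq_zero_iff] at h h'; simp at h h'; simp [h, h']
  have h4 : ¬ T.AllSingular := fun h => by
    obtain ⟨t, ht, ht'⟩ := hF
    simpa [e, det_fin_three, ht, ht'] using h ![1, t]
  have h5 : ¬ T.HasPure := not_hasPure fun x h => by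
    have k1 : x 0 = 0 ∨ x 1 = 0 := by simpa [e] using h.minor_eq 0 1 0 1
    have k2 : x 0 = 0 ∨ x 0 + x 1 = 0 := by simpa [e] using h.minor_eq 0 2 0 2
    have k3 : x 1 = 0 ∨ x 0 + x 1 = 0 := by simpa [e] using h.minor_eq 1 2 1 2
    rcases k1 with k | k <;> simp [k] at k2 k3 <;> simp [k, k2, k3]
  have h6 : T.HasThreeSingular := ⟨![1, 0], ![0, 1], ![1, -1], by simp [cross], by simp [cross],
    by simp [cross], by simp [e, det_fin_three], by simp [e, det_fin_three],
    by simp [e, det_fin_three]⟩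
  simp [index, h1, h2, h3, h4, h5, h6]

theorem index_fifteen : Pencil.index
    (![!![0, 0, 0; 1, 0, 0; 0, 0, 0], !![1, 0, 0; 0, 0, 0; 0, 0, 0]] : Pencil F) = 15 := by
  set T : Pencil F := ![!![0, 0, 0; 1, 0, 0; 0, 0, 0], !![1, 0, 0; 0, 0, 0; 0, 0, 0]] with hT
  have e : ∀ x, T.eval x = !![x 1, 0, 0; x 0, 0, 0; 0, 0, 0] := fun x => by
    rw [hT, eval_fin_three]; simp
  have h1 : ¬ T.HasZero := not_hasZero fun x h => by
    simp [e, fin_three_eq_zero_iff] at h; simp [h]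
  have h2 : T.LeftDegenerate := leftDegenerate_of_row 2 fun x j => by
    rw [e]; fin_cases j <;> simp
  have h3 : T.RightDegenerate := rightDegenerate_of_col 2 fun x j => by
    rw [e]; fin_cases j <;> simp
  have h5 : T.AllPure := fun x => ⟨![x 1, x 0, 0], ![1, 0, 0], by
    rw [e]; ext i j; fin_cases i <;> fin_cases j <;> simp [vecMulVec_apply]⟩
  have h6 : ¬ T.CommonColumn := by
    rintro ⟨y, hy⟩
    obtain ⟨z, hz⟩ := hy ![1, 0]
    obtain ⟨z', hz'⟩ := hy ![0, 1]
    have k1 := congrFun (congrFun hz 0) 0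
    have k2 := congrFun (congrFun hz 1) 0
    have k3 := congrFun (congrFun hz' 0) 0
    simp [e, vecMulVec_apply] at k1 k2 k3
    rcases k1 with k | k <;> simp [k] at k2 k3
  simp [index, h1, h2, h3, h5, h6]

theorem index_sixteen : Pencil.index
    (![!![0, 0, 0; 1, 0, 0; 0, 0, 1], !![1, 0, 0; 0, 0, 0; 0, 0, 0]] : Pencil F) = 16 := by
  set T : Pencil F := ![!![0, 0, 0; 1, 0, 0; 0, 0, 1], !![1, 0, 0; 0, 0, 0; 0, 0, 0]] with hT
  have e : ∀ x, T.eval x = !![x 1, 0, 0; x 0, 0, 0; 0, 0, x 0] := fun x => by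
    rw [hT, eval_fin_three]; simp
  have h1 : ¬ T.HasZero := not_hasZero fun x h => by
    simp [e, fin_three_eq_zero_iff] at h; simp [h]
  have h2 : ¬ T.LeftDegenerate := not_leftDegenerate fun w h h' => by
    rw [e, vecMul_fin_three_eq_zero_iff] at h h'; simp at h h'; simp [h, h']
  have h3 : T.RightDegenerate := rightDegenerate_of_col 1 fun x j => by
    rw [e]; fin_cases j <;> simp
  have h4 : T.HasPure := ⟨![0, 1], by simp, ![1, 0, 0], ![1, 0, 0], by
    rw [e]; ext i j; fin_cases i <;> fin_cases j <;> simp [vecMulVec_apply]⟩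
  simp [index, h1, h2, h3, h4]

theorem index_seventeen : Pencil.index
    (![!![0, 0, 0; 1, 0, 0; 0, 1, 0], !![0, 0, 0; 0, 1, 0; 0, 0, 1]] : Pencil F) = 17 := by
  set T : Pencil F := ![!![0, 0, 0; 1, 0, 0; 0, 1, 0], !![0, 0, 0; 0, 1, 0; 0, 0, 1]] with hT
  have e : ∀ x, T.eval x = !![0, 0, 0; x 0, x 1, 0; 0, x 0, x 1] := fun x => by
    rw [hT, eval_fin_three]; simp
  have h1 : ¬ T.HasZero := not_hasZero fun x h => by
    simp [e, fin_three_eq_zero_iff] at h; simp [h]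
  have h2 : T.LeftDegenerate := leftDegenerate_of_row 0 fun x j => by
    rw [e]; fin_cases j <;> simp
  have h3 : ¬ T.RightDegenerate := not_rightDegenerate fun v h h' => by
    rw [e, fin_three_mulVec_eq_zero_iff] at h h'; simp at h h'; simp [h, h']
  have h4 : ¬ T.HasPure := not_hasPure fun x h =>
    ⟨by simpa [e] using h.minor_eq 1 2 0 1, by simpa [e] using h.minor_eq 1 2 1 2⟩
  simp [index, h1, h2, h3, h4]

theorem index_eighteen (hF : ∀ s t : F, s * s + t * t = 0 → s = 0 ∧ t = 0) : Pencil.index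
    (![!![0, 0, 0; 0, 1, 0; 0, 0, -1], !![0, 0, 0; 0, 0, 1; 0, 1, 0]] : Pencil F) = 18 := by
  set T : Pencil F := ![!![0, 0, 0; 0, 1, 0; 0, 0, -1], !![0, 0, 0; 0, 0, 1; 0, 1, 0]] with hT
  have e : ∀ x, T.eval x = !![0, 0, 0; 0, x 0, x 1; 0, x 1, -x 0] := fun x => by
    rw [hT, eval_fin_three]; simp
  have h1 : ¬ T.HasZero := not_hasZero fun x h => by
    simp [e, fin_three_eq_zero_iff] at h; simp [h]
  have h2 : T.LeftDegenerate := leftDegenerate_of_row 0 fun x j => by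
    rw [e]; fin_cases j <;> simp
  have h3 : T.RightDegenerate := rightDegenerate_of_col 0 fun x j => by
    rw [e]; fin_cases j <;> simp
  have hp : ∀ x, IsPure (T.eval x) → x 0 = 0 ∧ x 1 = 0 := fun x h => by
    have k : x 0 * -x 0 = x 1 * x 1 := by simpa [e] using h.minor_eq 1 2 1 2
    exact hF _ _ (by linear_combination -k)
  have h4 : ¬ T.HasPure := not_hasPure hp
  have h5 : ¬ T.AllPure := fun h => by simpa using hp _ (h ![1, 0])
  have h6 : ¬ T.HasTwoPure := by
    rintro ⟨x, y, hxy, hx, hy⟩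
    simp [cross, hp x hx, hp y hy] at hxy
  simp [index, h1, h2, h3, h4, h5, h6]

/-- The determinant is `-x₀ (x₀² + x₁²)`, whose only zero is the simple one at `x₀ = 0`. Form 10 has
determinant `-x₀³`; among the tests, only the multiplicity of the zero tells the two apart. -/
theorem index_nineteen (hF : ∀ s t : F, s * s + t * t = 0 → s = 0 ∧ t = 0) : Pencil.index
    (![!![1, 0, 0; 0, 1, 0; 0, 0, -1], !![0, 0, 0; 0, 0, 1; 0, 1, 0]] : Pencil F) = 19 := by
  set T : Pencil F := ![!![1, 0, 0; 0, 1, 0; 0, 0, -1], !![0, 0, 0; 0, 0, 1; 0, 1, 0]] with hT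
  have e : ∀ x, T.eval x = !![x 0, 0, 0; 0, x 0, x 1; 0, x 1, -x 0] := fun x => by
    rw [hT, eval_fin_three]; simp
  have h1 : ¬ T.HasZero := not_hasZero fun x h => by
    simp [e, fin_three_eq_zero_iff] at h; simp [h]
  have h2 : ¬ T.LeftDegenerate := not_leftDegenerate fun w h h' => by
    rw [e, vecMul_fin_three_eq_zero_iff] at h h'; simp at h h'; simp [h]
  have h3 : ¬ T.RightDegenerate := not_rightDegenerate fun v h h' => by
    rw [e, fin_three_mulVec_eq_zero_iff] at h h'; simp at h h'; simp [h]
  have h4 : ¬ T.AllSingular := fun h => by simpa [e, det_fin_three] using h ![1, 0]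
  have h5 : ¬ T.HasPure := not_hasPure fun x h => by
    have k : x 0 * -x 0 = x 1 * x 1 := by simpa [e] using h.minor_eq 1 2 1 2
    exact hF _ _ (by linear_combination -k)
  have hd : ∀ x, (T.eval x).det = 0 → x 0 = 0 := fun x h => by
    have k : x 0 * (x 0 * x 0 + x 1 * x 1) = 0 := by
      rw [e] at h
      simp [det_fin_three] at h
      linear_combination -h
    rcases mul_eq_zero.1 k with k | k
    · exact k
    · exact (hF _ _ k).1
  have h6 : ¬ T.HasThreeSingular := not_hasThreeSingular fun x h => Or.inl (hd x h)
  have h7 : ¬ T.HasTwoSingular := not_hasTwoSingular hd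
  have h8 : ¬ T.HasDoubleZero := by
    rintro ⟨x, v, w, hx, hv, hw, hxv, hwx, hy⟩
    have hx0 : x 0 = 0 := hd x (Matrix.exists_mulVec_eq_zero_iff.1 ⟨v, hv, hxv⟩)
    have hx1 : x 1 ≠ 0 := fun h => hx (by ext i; fin_cases i <;> simp [hx0, h])
    rw [e, fin_three_mulVec_eq_zero_iff] at hxv
    rw [e, vecMul_fin_three_eq_zero_iff] at hwx
    simp [hx0, hx1] at hxv hwx
    have hv0 : v 0 ≠ 0 := fun h => hv (by ext i; fin_cases i <;> simp [hxv, h])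
    have hw0 : w 0 ≠ 0 := fun h => hw (by ext i; fin_cases i <;> simp [hwx, h])
    have := hy ![1, 0]
    simp [e, dotProduct, Matrix.mulVec, Fin.sum_univ_three, hxv, hwx, hv0, hw0] at this
  simp [index, h1, h2, h3, h4, h5, h6, h7, h8]

end Pencil

theorem index_normalForm (hF : ∃ t : F, t ≠ 0 ∧ 1 + t ≠ 0) (i : Fin 20)
    (hi : i < 18 ∨ ∀ s t : F, s * s + t * t = 0 → s = 0 ∧ t = 0) :
    (normalForm F i).index = i := by
  have hi' : ∀ j : Fin 20, 18 ≤ j → j = i → ∀ s t : F, s * s + t * t = 0 → s = 0 ∧ t = 0 := by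
    rintro j hj rfl
    exact hi.resolve_left (not_lt.2 hj)
  fin_cases i
  · exact Pencil.index_zero
  · exact Pencil.index_one
  · exact Pencil.index_two
  · exact Pencil.index_three
  · exact Pencil.index_four
  · exact Pencil.index_five
  · exact Pencil.index_six
  · exact Pencil.index_seven
  · exact Pencil.index_eight
  · exact Pencil.index_nine
  · exact Pencil.index_ten
  · exact Pencil.index_eleven
  · exact Pencil.index_twelve
  · exact Pencil.index_thirteen
  · exact Pencil.index_fourteen hF
  · exact Pencil.index_fifteen
  · exact Pencil.index_sixteen
  · exact Pencil.index_seventeen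
  · exact Pencil.index_eighteen (hi' 18 (by decide) rfl)
  · exact Pencil.index_nineteen (hi' 19 (by decide) rfl)

/-! ### Linear maps and pure tensors -/

section Pure

variable {U M Y : Type*} [AddCommGroup U] [Module F U] [AddCommGroup M] [Module F M]
  [AddCommGroup Y] [Module F Y]

/-- Contraction of the left factor with a functional. -/
def contractLeft (ξ : U →ₗ[F] F) : U ⊗[F] M →ₗ[F] M :=
  (TensorProduct.lid F M).toLinearMap ∘ₗ LinearMap.rTensor M ξ

@[simp]
theorem contractLeft_tmul (ξ : U →ₗ[F] F) (x : U) (m : M) :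
    contractLeft ξ (x ⊗ₜ[F] m) = ξ x • m := by
  simp [contractLeft]

theorem exists_functional_eq_one {x : U} (hx : x ≠ 0) : ∃ ξ : U →ₗ[F] F, ξ x = 1 := by
  obtain ⟨ξ, hξ⟩ := Module.Projective.exists_dual_ne_zero F hx
  exact ⟨(ξ x)⁻¹ • ξ, by simp [hξ]⟩

theorem exists_functional_eq_one_eq_zero {x y : U} (h : x ∉ Submodule.span F {y}) :
    ∃ ξ : U →ₗ[F] F, ξ x = 1 ∧ ξ y = 0 := by
  obtain ⟨ξ, hξ, hy⟩ := Submodule.exists_dual_map_eq_bot_of_notMem h inferInstance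
  have hy' : ξ y = 0 := by
    have : ξ y ∈ (Submodule.span F {y}).map ξ :=
      Submodule.mem_map_of_mem (Submodule.mem_span_singleton_self y)
    simpa [hy] using this
  exact ⟨(ξ x)⁻¹ • ξ, by simp [hξ], by simp [hy']⟩

theorem tmul_ne_zero {x : U} {m : M} (hx : x ≠ 0) (hm : m ≠ 0) : x ⊗ₜ[F] m ≠ 0 := by
  obtain ⟨ξ, hξ⟩ := exists_functional_eq_one (F := F) hx
  intro h
  apply hm
  simpa [hξ] using congrArg (contractLeft (M := M) ξ) h

theorem exists_smul_eq_of_tmul_eq {u u' : U} {m m' : M} (hm : m ≠ 0)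
    (h : u ⊗ₜ[F] m = u' ⊗ₜ[F] m') : ∃ c : F, u = c • u' := by
  obtain ⟨η, hη⟩ := exists_functional_eq_one (F := F) hm
  refine ⟨η m', ?_⟩
  simpa [hη] using congrArg (fun t => contractLeft η (TensorProduct.comm F U M t)) h

/-- Contracting with functionals dual to the independent vectors `x₁`, `x₂` shows that `m₁` and `m₂`
are both multiples of `m'`. -/
theorem exists_smul_eq_of_add_eq_tmul {x₁ x₂ x' : U} {m₁ m₂ m' : M}
    (h₁ : x₁ ∉ Submodule.span F {x₂}) (hx₂ : x₂ ≠ 0) (hm₁ : m₁ ≠ 0)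
    (h : x₁ ⊗ₜ[F] m₁ + x₂ ⊗ₜ[F] m₂ = x' ⊗ₜ[F] m') : ∃ c : F, m₂ = c • m₁ := by
  have h₂ : x₂ ∉ Submodule.span F {x₁} := by
    intro h2
    obtain ⟨c, hc⟩ := Submodule.mem_span_singleton.1 h2
    have hc0 : c ≠ 0 := by
      rintro rfl
      exact hx₂ (by simpa using hc.symm)
    exact h₁ (Submodule.mem_span_singleton.2 ⟨c⁻¹, by rw [← hc, smul_smul, inv_mul_cancel₀ hc0,
      one_smul]⟩)
  obtain ⟨ξ, hξ, hξ'⟩ := exists_functional_eq_one_eq_zero h₁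
  obtain ⟨η, hη, hη'⟩ := exists_functional_eq_one_eq_zero h₂
  have e₁ : m₁ = ξ x' • m' := by simpa [hξ, hξ'] using congrArg (contractLeft ξ) h
  have e₂ : m₂ = η x' • m' := by simpa [hη, hη'] using congrArg (contractLeft η) h
  have hc : ξ x' ≠ 0 := by
    intro h0
    exact hm₁ (by rw [e₁, h0, zero_smul])
  exact ⟨η x' * (ξ x')⁻¹, by rw [e₂, e₁, smul_smul, mul_assoc, inv_mul_cancel₀ hc, mul_one]⟩

/-- A linear space of pure tensors has a common left or a common right factor. -/
theorem exists_common_factor (l : Y →ₗ[F] U ⊗[F] M)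
    (hl : ∀ y, ∃ (u : U) (m : M), l y = u ⊗ₜ[F] m) :
    (∃ u : U, ∀ y, ∃ m : M, l y = u ⊗ₜ[F] m) ∨ ∃ m : M, ∀ y, ∃ u : U, l y = u ⊗ₜ[F] m := by
  by_cases h0 : ∀ y, l y = 0
  · exact Or.inl ⟨0, fun y => ⟨0, by simp [h0]⟩⟩
  push Not at h0
  obtain ⟨y₁, hy₁⟩ := h0
  obtain ⟨x₁, m₁, h₁⟩ := hl y₁
  have hm₁ : m₁ ≠ 0 := by rintro rfl; simp [h₁] at hy₁
  have hx₁ : x₁ ≠ 0 := by rintro rfl; simp [h₁] at hy₁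
  by_cases h : ∀ y, ∃ m, l y = x₁ ⊗ₜ[F] m
  · exact Or.inl ⟨x₁, h⟩
  push Not at h
  obtain ⟨y₂, hy₂⟩ := h
  obtain ⟨x₂, m₂, h₂⟩ := hl y₂
  have hm₂ : m₂ ≠ 0 := by rintro rfl; exact hy₂ 0 (by simp [h₂])
  have hx₂ : x₂ ∉ Submodule.span F {x₁} := by
    intro hx
    obtain ⟨c, rfl⟩ := Submodule.mem_span_singleton.1 hx
    exact hy₂ (c • m₂) (by rw [h₂, TensorProduct.smul_tmul])
  have hx₂' : x₂ ≠ 0 := by rintro rfl; exact hy₂ 0 (by simp [h₂])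
  have hsum : ∀ a b, ∃ u m, l a + l b = u ⊗ₜ[F] m := fun a b => by
    obtain ⟨u, m, h⟩ := hl (a + b)
    exact ⟨u, m, by rw [← h, map_add]⟩
  have h12 : ∃ c : F, m₁ = c • m₂ := by
    obtain ⟨u, m, h⟩ := hsum y₂ y₁
    rw [h₁, h₂] at h
    exact exists_smul_eq_of_add_eq_tmul hx₂ hx₁ hm₂ h
  obtain ⟨c, hc⟩ := h12
  have hc0 : c ≠ 0 := by rintro rfl; exact hm₁ (by simpa using hc)
  refine Or.inr ⟨m₁, fun y => ?_⟩
  obtain ⟨x, m, hy⟩ := hl y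
  by_cases hm : m = 0
  · exact ⟨0, by simp [hy, hm]⟩
  by_cases hx0 : x = 0
  · exact ⟨0, by simp [hy, hx0]⟩
  suffices h : ∃ d : F, m = d • m₁ by
    obtain ⟨d, rfl⟩ := h
    exact ⟨d • x, by rw [hy, TensorProduct.smul_tmul]⟩
  -- Since `x₁` and `x₂` are independent, `x` is independent of at least one of them; the
  -- corresponding right factor, `m₁` or its multiple `m₂`, is then proportional to `m`.
  by_cases hx : x ∈ Submodule.span F {x₁}
  · have hx₂x : x₂ ∉ Submodule.span F {x} := by
      intro h
      exact hx₂ ((Submodule.span_singleton_le_iff_mem _ _).2 hx h)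
    obtain ⟨u, m', h⟩ := hsum y₂ y
    rw [h₂, hy] at h
    obtain ⟨d, hd⟩ := exists_smul_eq_of_add_eq_tmul hx₂x hx0 hm₂ h
    exact ⟨d * c⁻¹, by rw [hc, smul_smul, mul_assoc, inv_mul_cancel₀ hc0, mul_one, hd]⟩
  · obtain ⟨u, m', h⟩ := hsum y y₁
    rw [hy, h₁] at h
    obtain ⟨d, hd⟩ := exists_smul_eq_of_add_eq_tmul hx hx₁ hm h
    have hd0 : d ≠ 0 := by rintro rfl; exact hm₁ (by simpa using hd)
    exact ⟨d⁻¹, by rw [hd, smul_smul, inv_mul_cancel₀ hd0, one_smul]⟩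

/-- With a common right factor `l` would induce an injection of `Y` into the smaller space `U`. -/
theorem exists_common_left_factor [Module.Finite F U] [Module.Finite F Y]
    (l : Y →ₗ[F] U ⊗[F] M) (hl : ∀ y, ∃ (u : U) (m : M), l y = u ⊗ₜ[F] m)
    (hinj : Function.Injective l) (hdim : Module.finrank F U < Module.finrank F Y) :
    ∃ u : U, ∀ y, ∃ m : M, l y = u ⊗ₜ[F] m := by
  refine (exists_common_factor l hl).resolve_right ?_
  rintro ⟨m, hm⟩
  by_cases hm0 : m = 0
  · have : ∀ y : Y, y = 0 := fun y => hinj (by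
      obtain ⟨u, hu⟩ := hm y
      rw [hu, hm0, map_zero, TensorProduct.tmul_zero])
    have : Subsingleton Y := ⟨fun a b => by rw [this a, this b]⟩
    rw [Module.finrank_zero_of_subsingleton (R := F) (M := Y)] at hdim
    omega
  · obtain ⟨η, hη⟩ := exists_functional_eq_one (F := F) hm0
    let k : Y →ₗ[F] U := contractLeft η ∘ₗ (TensorProduct.comm F U M).toLinearMap ∘ₗ l
    have hk : ∀ y, l y = k y ⊗ₜ[F] m := by
      intro y
      obtain ⟨u, hu⟩ := hm y
      simp [k, hu, hη]
    have : Function.Injective k := fun a b hab => hinj (by rw [hk, hk, hab])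
    exact absurd (LinearMap.finrank_le_finrank_of_injective this) (not_le.2 hdim)

/-- An automorphism of `U ⊗ M` mapping every `x ⊗ M` to some `u ⊗ M` is a tensor product of
automorphisms. -/
theorem exists_eq_congr [Module.Finite F U] [Module.Finite F M] [Nontrivial U] [Nontrivial M]
    (g : (U ⊗[F] M) ≃ₗ[F] (U ⊗[F] M))
    (hg : ∀ x, ∃ u, ∀ m, ∃ m', g (x ⊗ₜ[F] m) = u ⊗ₜ[F] m') :
    ∃ (g₁ : U ≃ₗ[F] U) (φ : M ≃ₗ[F] M), g = TensorProduct.congr g₁ φ := by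
  obtain ⟨m₀, hm₀⟩ := exists_ne (0 : M)
  have key : ∀ x : U, x ≠ 0 → ∃ (u : U) (φ : M →ₗ[F] M), ∀ m, g (x ⊗ₜ[F] m) = u ⊗ₜ[F] φ m := by
    intro x hx
    obtain ⟨u, hu⟩ := hg x
    have hu0 : u ≠ 0 := by
      rintro rfl
      obtain ⟨m', h⟩ := hu m₀
      rw [TensorProduct.zero_tmul, g.map_eq_zero_iff] at h
      exact tmul_ne_zero hx hm₀ h
    obtain ⟨ξ, hξ⟩ := exists_functional_eq_one (F := F) hu0
    refine ⟨u, contractLeft ξ ∘ₗ g.toLinearMap ∘ₗ TensorProduct.mk F U M x, fun m => ?_⟩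
    obtain ⟨m', h⟩ := hu m
    simp [h, hξ]
  let b := Module.finBasis F U
  -- On each slice `b i ⊗ M` the map `g` has its own second component `φ i`. The slice over the sum
  -- of the basis forces all `φ i` to be multiples of one map `ψ`.
  have hs : ∑ i, b i ≠ 0 := by
    intro h
    have hn : 0 < Module.finrank F U := Module.finrank_pos
    have := congrArg (fun v => b.repr v ⟨0, hn⟩) h
    simp [Finsupp.single_apply] at this
  choose f φ hf using fun i => key (b i) (b.ne_zero i)
  obtain ⟨v, ψ, hv⟩ := key _ hs
  -- Otherwise a nonzero functional on `U` would kill all `f i`, and its contraction would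
  -- annihilate the image of the surjective `g`.
  have hspan : ⊤ ≤ Submodule.span F (Set.range f) := by
    by_contra hne
    obtain ⟨x, -, hx⟩ := SetLike.not_le_iff_exists.1 hne
    obtain ⟨ξ, hξ, hbot⟩ := Submodule.exists_dual_map_eq_bot_of_notMem hx inferInstance
    have hξf : ∀ i, ξ (f i) = 0 := by
      intro i
      have : ξ (f i) ∈ (Submodule.span F (Set.range f)).map ξ :=
        Submodule.mem_map_of_mem (Submodule.subset_span ⟨i, rfl⟩)
      simpa [hbot] using this
    have h0 : contractLeft (M := M) ξ ∘ₗ g.toLinearMap = 0 := by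
      apply TensorProduct.ext
      refine b.ext fun i => ?_
      ext m
      simp [hf, hξf]
    have h1 := LinearMap.congr_fun h0 (g.symm (x ⊗ₜ[F] m₀))
    simp [hξ, hm₀] at h1
  have hli : LinearIndependent F f :=
    linearIndependent_of_top_le_span_of_card_eq_finrank hspan (by simp)
  let c := Module.Basis.mk hli hspan
  have hc : ∀ i, c i = f i := fun i => by simp [c]
  have hφ : ∀ i m, φ i m = c.repr v i • ψ m := by
    intro i m
    have h1 : ∑ j, c j ⊗ₜ[F] φ j m = v ⊗ₜ[F] ψ m := by
      rw [← hv, TensorProduct.sum_tmul, map_sum]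
      simp [hf, hc]
    have h2 := congrArg (contractLeft (c.coord i)) h1
    simpa [Finsupp.single_apply, ite_smul, map_sum] using h2
  let g₁ : U →ₗ[F] U := b.constr F fun i => c.repr v i • f i
  have hg₁ : ∀ x m, g (x ⊗ₜ[F] m) = g₁ x ⊗ₜ[F] ψ m := by
    have : g.toLinearMap = TensorProduct.map g₁ ψ := by
      apply TensorProduct.ext
      refine b.ext fun i => ?_
      ext m
      simp [g₁, hf, hφ, TensorProduct.smul_tmul]
    intro x m
    exact LinearMap.congr_fun this (x ⊗ₜ[F] m)
  obtain ⟨x₀, hx₀⟩ := exists_ne (0 : U)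
  have i₁ : Function.Injective g₁ := by
    rw [injective_iff_map_eq_zero]
    intro x hx
    by_contra hne
    have := hg₁ x m₀
    rw [hx, TensorProduct.zero_tmul, g.map_eq_zero_iff] at this
    exact tmul_ne_zero hne hm₀ this
  have i₂ : Function.Injective ψ := by
    rw [injective_iff_map_eq_zero]
    intro m hm
    by_contra hne
    have := hg₁ x₀ m
    rw [hm, TensorProduct.tmul_zero, g.map_eq_zero_iff] at this
    exact tmul_ne_zero hx₀ hne this
  refine ⟨LinearEquiv.ofInjectiveEndo g₁ i₁, LinearEquiv.ofInjectiveEndo ψ i₂, ?_⟩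
  apply LinearEquiv.toLinearMap_injective
  ext x m
  simp [hg₁]

/-- An automorphism of `U ⊗ U` preserving pure tensors is a tensor product of automorphisms, up to
interchanging the factors. -/
theorem exists_eq_congr_or_comm [Module.Finite F U] [Nontrivial U]
    (g : (U ⊗[F] U) ≃ₗ[F] (U ⊗[F] U))
    (hg : ∀ x y, ∃ u v, g (x ⊗ₜ[F] y) = u ⊗ₜ[F] v) :
    ∃ g₁ g₂ : U ≃ₗ[F] U, g = TensorProduct.congr g₁ g₂ ∨
      g = TensorProduct.congr g₁ g₂ ≪≫ₗ TensorProduct.comm F U U := by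
  let l : U → U →ₗ[F] U ⊗[F] U := fun x => g.toLinearMap ∘ₗ TensorProduct.mk F U U x
  have hl : ∀ x y, l x y = g (x ⊗ₜ[F] y) := fun x y => rfl
  have hdich : ∀ x, (∃ u, ∀ y, ∃ v, g (x ⊗ₜ[F] y) = u ⊗ₜ[F] v) ∨
      ∃ v, ∀ y, ∃ u, g (x ⊗ₜ[F] y) = u ⊗ₜ[F] v := fun x =>
    exists_common_factor (l x) (hg x)
  have hall : (∀ x, ∃ u, ∀ y, ∃ v, g (x ⊗ₜ[F] y) = u ⊗ₜ[F] v) ∨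
      ∀ x, ∃ v, ∀ y, ∃ u, g (x ⊗ₜ[F] y) = u ⊗ₜ[F] v := by
    -- Suppose that `x₁` gives only a common left factor `u` and `x₂` only a common right factor
    -- `v`. For `z` outside `A` and `B`, the image of `(x₁ + x₂) ⊗ z` is `u ⊗ p + q ⊗ v` with `q`
    -- not proportional to `u` and `p` not proportional to `v`, so it is not pure.
    by_contra hcon
    rw [not_or, not_forall, not_forall] at hcon
    obtain ⟨⟨x₂, hx₂⟩, x₁, hx₁⟩ := hcon
    obtain ⟨u, hu⟩ := (hdich x₁).resolve_right hx₁
    obtain ⟨v, hv⟩ := (hdich x₂).resolve_left hx₂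
    let A : Submodule F U := (LinearMap.range ((TensorProduct.mk F U U).flip v)).comap (l x₁)
    let B : Submodule F U := (LinearMap.range (TensorProduct.mk F U U u)).comap (l x₂)
    have hA : ∃ z, z ∉ A := by
      by_contra h
      push Not at h
      exact hx₁ ⟨v, fun y => by obtain ⟨w, hw⟩ := h y; exact ⟨w, hw.symm⟩⟩
    have hB : ∃ z, z ∉ B := by
      by_contra h
      push Not at h
      exact hx₂ ⟨u, fun y => by obtain ⟨w, hw⟩ := h y; exact ⟨w, hw.symm⟩⟩
    -- A vector space is not the union of two proper subspaces.
    have hAB : ∃ z, z ∉ A ∧ z ∉ B := by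
      obtain ⟨z₁, h₁⟩ := hA
      obtain ⟨z₂, h₂⟩ := hB
      by_cases k₁ : z₁ ∈ B
      · by_cases k₂ : z₂ ∈ A
        · exact ⟨z₁ + z₂, fun h => h₁ ((A.add_mem_iff_left k₂).1 h),
            fun h => h₂ ((B.add_mem_iff_right k₁).1 h)⟩
        · exact ⟨z₂, k₂, h₂⟩
      · exact ⟨z₁, h₁, k₁⟩
    obtain ⟨z, hzA, hzB⟩ := hAB
    obtain ⟨p, hp⟩ := hu z
    obtain ⟨q, hq⟩ := hv z
    obtain ⟨r, s, hrs⟩ := hg (x₁ + x₂) z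
    rw [TensorProduct.add_tmul, map_add, hp, hq, add_comm] at hrs
    have hzA' : ∀ w, g (x₁ ⊗ₜ[F] z) ≠ w ⊗ₜ[F] v := fun w hw => hzA ⟨w, hw.symm⟩
    have hzB' : ∀ w, g (x₂ ⊗ₜ[F] z) ≠ u ⊗ₜ[F] w := fun w hw => hzB ⟨w, hw.symm⟩
    rw [hp] at hzA'
    rw [hq] at hzB'
    have hv0 : v ≠ 0 := by rintro rfl; exact hzB' 0 (by simp)
    have hu0 : u ≠ 0 := by rintro rfl; exact hzA' 0 (by simp)
    have hqu : q ∉ Submodule.span F {u} := by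
      intro h
      obtain ⟨c, rfl⟩ := Submodule.mem_span_singleton.1 h
      exact hzB' (c • v) (by rw [TensorProduct.smul_tmul])
    obtain ⟨c, rfl⟩ := exists_smul_eq_of_add_eq_tmul hqu hu0 hv0 hrs
    exact hzA' (c • u) (by rw [TensorProduct.smul_tmul])
  rcases hall with h | h
  · obtain ⟨g₁, g₂, h⟩ := exists_eq_congr g h
    exact ⟨g₁, g₂, Or.inl h⟩
  · obtain ⟨g₁, g₂, h⟩ := exists_eq_congr (g ≪≫ₗ TensorProduct.comm F U U) fun x => by
      obtain ⟨v, hv⟩ := h x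
      refine ⟨v, fun y => ?_⟩
      obtain ⟨u, hu⟩ := hv y
      exact ⟨u, by simp [hu]⟩
    refine ⟨g₁, g₂, Or.inr ?_⟩
    rw [← h]
    ext t
    simp

end Pure

/-! ### The stabiliser of the fundamental tensors -/

section Stabiliser

variable {V₁ V₂ V₃ : Type*} [AddCommGroup V₁] [Module F V₁]
  [AddCommGroup V₂] [Module F V₂] [AddCommGroup V₃] [Module F V₃]

theorem mem_groupG_of_forall (g : (V₁ ⊗[F] (V₂ ⊗[F] V₃)) ≃ₗ[F] (V₁ ⊗[F] (V₂ ⊗[F] V₃)))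
    (h : ∀ t ∈ fundamentalThree F V₁ V₂ V₃, g t ∈ fundamentalThree F V₁ V₂ V₃)
    (h' : ∀ t ∈ fundamentalThree F V₁ V₂ V₃, g.symm t ∈ fundamentalThree F V₁ V₂ V₃) :
    g ∈ groupG F V₁ V₂ V₃ := by
  rw [groupG, MulAction.mem_stabilizer_iff]
  ext t
  constructor
  · rintro ⟨s, hs, rfl⟩
    exact h s hs
  · intro ht
    exact ⟨g.symm t, h' t ht, g.apply_symm_apply t⟩

theorem apply_mem_of_mem_groupG {g : (V₁ ⊗[F] (V₂ ⊗[F] V₃)) ≃ₗ[F] (V₁ ⊗[F] (V₂ ⊗[F] V₃))}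
    (hg : g ∈ groupG F V₁ V₂ V₃) {t : V₁ ⊗[F] (V₂ ⊗[F] V₃)}
    (ht : t ∈ fundamentalThree F V₁ V₂ V₃) : g t ∈ fundamentalThree F V₁ V₂ V₃ := by
  rw [groupG, MulAction.mem_stabilizer_iff] at hg
  rw [← hg]
  exact ⟨t, ht, rfl⟩

theorem groupH_le_groupG : groupH F V₁ V₂ V₃ ≤ groupG F V₁ V₂ V₃ := by
  rintro _ ⟨⟨g₁, g₂, g₃⟩, rfl⟩
  refine mem_groupG_of_forall _ ?_ ?_
  · rintro _ ⟨v₁, v₂, v₃, h₁, h₂, h₃, rfl⟩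
    exact ⟨g₁ v₁, g₂ v₂, g₃ v₃, by simpa using h₁, by simpa using h₂, by simpa using h₃, rfl⟩
  · rintro _ ⟨v₁, v₂, v₃, h₁, h₂, h₃, rfl⟩
    exact ⟨g₁.symm v₁, g₂.symm v₂, g₃.symm v₃, by simpa using h₁, by simpa using h₂,
      by simpa using h₃, rfl⟩

/-- The interchange of the last two factors. -/
def swapLast (F V₁ V₂ : Type*) [Field F] [AddCommGroup V₁] [Module F V₁]
    [AddCommGroup V₂] [Module F V₂] :
    (V₁ ⊗[F] (V₂ ⊗[F] V₂)) ≃ₗ[F] (V₁ ⊗[F] (V₂ ⊗[F] V₂)) :=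
  TensorProduct.congr (LinearEquiv.refl F V₁) (TensorProduct.comm F V₂ V₂)

theorem swapLast_mem_groupG : swapLast F V₁ V₂ ∈ groupG F V₁ V₂ V₂ := by
  refine mem_groupG_of_forall _ ?_ ?_ <;>
  · rintro _ ⟨v₁, v₂, v₃, h₁, h₂, h₃, rfl⟩
    exact ⟨v₁, v₃, v₂, h₁, h₃, h₂, rfl⟩

/-- Elements of `G` map `x ⊗ (V₂ ⊗ V₂)` to some `u ⊗ (V₂ ⊗ V₂)` if `dim V₁ < dim V₂`. -/
theorem exists_left_factor_of_mem_groupG [Module.Finite F V₁] [Module.Finite F V₂]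
    (hdim : Module.finrank F V₁ < Module.finrank F V₂)
    {g : (V₁ ⊗[F] (V₂ ⊗[F] V₂)) ≃ₗ[F] (V₁ ⊗[F] (V₂ ⊗[F] V₂))}
    (hg : g ∈ groupG F V₁ V₂ V₂) (x : V₁) :
    ∃ u, ∀ m, ∃ m', g (x ⊗ₜ[F] m) = u ⊗ₜ[F] m' := by
  by_cases hx : x = 0
  · exact ⟨0, fun m => ⟨0, by simp [hx]⟩⟩
  have hV : Nontrivial V₂ := Module.nontrivial_of_finrank_pos (R := F) (by omega)
  obtain ⟨z₀, hz₀⟩ := exists_ne (0 : V₂)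
  have hne : ∀ y z : V₂, y ≠ 0 → z ≠ 0 → g (x ⊗ₜ[F] (y ⊗ₜ[F] z)) ≠ 0 := fun y z hy hz h =>
    tmul_ne_zero hx (tmul_ne_zero hy hz) (g.map_eq_zero_iff.1 h)
  have hpure : ∀ y z : V₂, ∃ u m, g (x ⊗ₜ[F] (y ⊗ₜ[F] z)) = u ⊗ₜ[F] m := by
    intro y z
    by_cases hy : y = 0
    · exact ⟨0, 0, by simp [hy]⟩
    by_cases hz : z = 0
    · exact ⟨0, 0, by simp [hz]⟩
    obtain ⟨u, v, w, -, -, -, h⟩ := apply_mem_of_mem_groupG hg ⟨x, y, z, hx, hy, hz, rfl⟩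
    exact ⟨u, _, h⟩
  -- Here `dim V₁ < dim V₂` matters: a `V₂` of pure tensors cannot vary in the first factor.
  have h₁ : ∀ z : V₂, z ≠ 0 → ∃ u, ∀ y, ∃ m, g (x ⊗ₜ[F] (y ⊗ₜ[F] z)) = u ⊗ₜ[F] m := by
    intro z hz
    refine exists_common_left_factor (g.toLinearMap ∘ₗ TensorProduct.mk F V₁ _ x ∘ₗ
      (TensorProduct.mk F V₂ V₂).flip z) (fun y => hpure y z) ?_ hdim
    rw [injective_iff_map_eq_zero]
    intro y hy
    by_contra hy0
    exact hne y z hy0 hz hy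
  have h₂ : ∀ y : V₂, y ≠ 0 → ∃ u, ∀ z, ∃ m, g (x ⊗ₜ[F] (y ⊗ₜ[F] z)) = u ⊗ₜ[F] m := by
    intro y hy
    refine exists_common_left_factor (g.toLinearMap ∘ₗ TensorProduct.mk F V₁ _ x ∘ₗ
      TensorProduct.mk F V₂ V₂ y) (fun z => hpure y z) ?_ hdim
    rw [injective_iff_map_eq_zero]
    intro z hz
    by_contra hz0
    exact hne y z hy hz0 hz
  obtain ⟨u₀, hu₀⟩ := h₁ z₀ hz₀
  let N : Submodule F (V₂ ⊗[F] V₂) :=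
    (LinearMap.range (TensorProduct.mk F V₁ (V₂ ⊗[F] V₂) u₀)).comap
      (g.toLinearMap ∘ₗ TensorProduct.mk F V₁ _ x)
  -- The left factor belonging to `y` and the left factor `u₀` belonging to `z₀` are compared at `y
  -- ⊗ z₀`, whose image is nonzero; so they are proportional.
  have hN : ∀ y z : V₂, y ⊗ₜ[F] z ∈ N := by
    intro y z
    by_cases hy : y = 0
    · rw [hy, TensorProduct.zero_tmul]; exact N.zero_mem
    obtain ⟨u, hu⟩ := h₂ y hy
    obtain ⟨m, hm⟩ := hu z₀
    obtain ⟨m', hm'⟩ := hu₀ y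
    obtain ⟨m'', hm''⟩ := hu z
    have hm0 : m ≠ 0 := by
      rintro rfl
      exact hne y z₀ hy hz₀ (by simp [hm])
    obtain ⟨c, rfl⟩ := exists_smul_eq_of_tmul_eq hm0 (hm.symm.trans hm')
    exact ⟨c • m'', by simp [hm'', TensorProduct.smul_tmul]⟩
  refine ⟨u₀, fun m => ?_⟩
  have hm : m ∈ N := by
    induction m using TensorProduct.induction_on with
    | zero => exact N.zero_mem
    | tmul y z => exact hN y z
    | add a b ha hb => exact N.add_mem ha hb
  obtain ⟨m', hm'⟩ := hm
  exact ⟨m', hm'.symm⟩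

/-- The group `G` is generated by `H` and the interchange of the last two factors. -/
theorem mem_groupH_or_of_mem_groupG [Module.Finite F V₁] [Module.Finite F V₂] [Nontrivial V₁]
    (hdim : Module.finrank F V₁ < Module.finrank F V₂)
    {g : (V₁ ⊗[F] (V₂ ⊗[F] V₂)) ≃ₗ[F] (V₁ ⊗[F] (V₂ ⊗[F] V₂))}
    (hg : g ∈ groupG F V₁ V₂ V₂) :
    ∃ h ∈ groupH F V₁ V₂ V₂, g = h ∨ g = swapLast F V₁ V₂ * h := by
  have hV : Nontrivial V₂ := Module.nontrivial_of_finrank_pos (R := F) (by omega)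
  have hVV : Nontrivial (V₂ ⊗[F] V₂) := by
    obtain ⟨z, hz⟩ := exists_ne (0 : V₂)
    exact ⟨_, _, tmul_ne_zero (F := F) hz hz⟩
  obtain ⟨g₁, φ, hgφ⟩ := exists_eq_congr g (exists_left_factor_of_mem_groupG hdim hg)
  obtain ⟨x, hx⟩ := exists_ne (0 : V₁)
  -- Contraction with `ξ` recovers `φ (y ⊗ z)` from the fundamental tensor `g (x ⊗ y ⊗ z)`, so `φ`
  -- preserves pure tensors.
  obtain ⟨ξ, hξ⟩ := exists_functional_eq_one (F := F) (x := g₁ x) (by simpa using hx)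
  obtain ⟨g₂, g₃, h⟩ := exists_eq_congr_or_comm φ fun y z => by
    by_cases hy : y = 0
    · exact ⟨0, 0, by simp [hy]⟩
    by_cases hz : z = 0
    · exact ⟨0, 0, by simp [hz]⟩
    obtain ⟨u, v, w, -, -, -, h⟩ := apply_mem_of_mem_groupG hg ⟨x, y, z, hx, hy, hz, rfl⟩
    refine ⟨ξ u • v, w, ?_⟩
    simpa [hgφ, hξ, TensorProduct.smul_tmul'] using congrArg (contractLeft ξ) h
  refine ⟨TensorProduct.congr g₁ (TensorProduct.congr g₂ g₃), ⟨⟨g₁, g₂, g₃⟩, rfl⟩, ?_⟩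
  rcases h with rfl | rfl
  · exact Or.inl hgφ
  · refine Or.inr ?_
    rw [hgφ]
    apply LinearEquiv.toLinearMap_injective
    ext a b c
    simp [swapLast]

end Stabiliser

/-! ### Tensors as pencils, and group orbits as equivalence classes -/

section Coordinates

/-- The tensor product with a space of functions is a space of functions. -/
def piScalarLeft (ι M : Type*) [Fintype ι] [DecidableEq ι] [AddCommGroup M] [Module F M] :
    ((ι → F) ⊗[F] M) ≃ₗ[F] (ι → M) :=
  TensorProduct.comm F (ι → F) M ≪≫ₗ TensorProduct.piScalarRight F F M ι

theorem piScalarLeft_tmul {ι M : Type*} [Fintype ι] [DecidableEq ι] [AddCommGroup M] [Module F M]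
    (x : ι → F) (m : M) (i : ι) : piScalarLeft ι M (x ⊗ₜ[F] m) i = x i • m := by
  simp [piScalarLeft]

/-- The matrix of a tensor in `F³ ⊗ F³`. -/
def toMat (F : Type*) [Field F] :
    ((Fin 3 → F) ⊗[F] (Fin 3 → F)) ≃ₗ[F] Matrix (Fin 3) (Fin 3) F :=
  piScalarLeft (Fin 3) (Fin 3 → F) ≪≫ₗ Matrix.ofLinearEquiv F

@[simp]
theorem toMat_tmul (y z : Fin 3 → F) : toMat F (y ⊗ₜ[F] z) = vecMulVec y z := by
  ext i j
  simp [toMat, piScalarLeft_tmul, vecMulVec_apply]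

/-- The pencil of a tensor in `F² ⊗ F³ ⊗ F³`. -/
def toPencil (F : Type*) [Field F] : Space F ≃ₗ[F] Pencil F :=
  TensorProduct.congr (LinearEquiv.refl F _) (toMat F) ≪≫ₗ piScalarLeft (Fin 2) _

theorem toPencil_tmul (x : Fin 2 → F) (m : (Fin 3 → F) ⊗[F] (Fin 3 → F)) (i : Fin 2) :
    toPencil F (x ⊗ₜ[F] m) i = x i • toMat F m := by
  simp [toPencil, piScalarLeft_tmul]

theorem toMat_map (f₂ f₃ : (Fin 3 → F) →ₗ[F] (Fin 3 → F))
    (m : (Fin 3 → F) ⊗[F] (Fin 3 → F)) :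
    toMat F (TensorProduct.map f₂ f₃ m) =
      LinearMap.toMatrix' f₂ * toMat F m * (LinearMap.toMatrix' f₃)ᵀ := by
  induction m using TensorProduct.induction_on with
  | zero => simp
  | tmul y z =>
    rw [TensorProduct.map_tmul, toMat_tmul, toMat_tmul, Matrix.mul_vecMulVec,
      Matrix.vecMulVec_mul, Matrix.vecMul_transpose, LinearMap.toMatrix'_mulVec,
      LinearMap.toMatrix'_mulVec]
  | add a b ha hb => simp only [map_add, ha, hb, Matrix.mul_add, Matrix.add_mul]

theorem toPencil_map (f₁ : (Fin 2 → F) →ₗ[F] (Fin 2 → F))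
    (f₂ f₃ : (Fin 3 → F) →ₗ[F] (Fin 3 → F)) (t : Space F) (i : Fin 2) :
    toPencil F (TensorProduct.map f₁ (TensorProduct.map f₂ f₃) t) i =
      ∑ j, LinearMap.toMatrix' f₁ i j •
        (LinearMap.toMatrix' f₂ * toPencil F t j * (LinearMap.toMatrix' f₃)ᵀ) := by
  induction t using TensorProduct.induction_on with
  | zero => simp only [LinearMap.map_zero, LinearEquiv.map_zero, Pi.zero_apply, Matrix.mul_zero,
      Matrix.zero_mul, smul_zero, Finset.sum_const_zero]
  | tmul x m =>
    have hx : f₁ x i = ∑ j, LinearMap.toMatrix' f₁ i j * x j := by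
      rw [← LinearMap.toMatrix'_mulVec f₁ x]
      rfl
    simp only [TensorProduct.map_tmul, toPencil_tmul, toMat_map, hx, Matrix.mul_smul,
      Matrix.smul_mul, smul_smul, Finset.sum_smul]
  | add a b ha hb =>
    simp only [map_add, Pi.add_apply, ha, hb, Matrix.mul_add, Matrix.add_mul, smul_add,
      Finset.sum_add_distrib]

theorem toPencil_swapLast (t : Space F) (i : Fin 2) :
    toPencil F (swapLast F (Fin 2 → F) (Fin 3 → F) t) i = (toPencil F t i)ᵀ := by
  have hm : ∀ m : (Fin 3 → F) ⊗[F] (Fin 3 → F),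
      toMat F (TensorProduct.comm F _ _ m) = (toMat F m)ᵀ := by
    intro m
    induction m using TensorProduct.induction_on with
    | zero => simp
    | tmul y z => simp [Matrix.transpose_vecMulVec]
    | add a b ha hb => simp only [map_add, ha, hb, Matrix.transpose_add]
  induction t using TensorProduct.induction_on with
  | zero => simp only [LinearEquiv.map_zero, Pi.zero_apply, Matrix.transpose_zero]
  | tmul x m =>
    simp only [swapLast, TensorProduct.congr_tmul, toPencil_tmul, hm, Matrix.transpose_smul,
      LinearEquiv.refl_apply]
  | add a b ha hb => simp only [map_add, Pi.add_apply, ha, hb, Matrix.transpose_add]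

theorem det_toMatrix'_ne_zero {n : ℕ} (f : (Fin n → F) ≃ₗ[F] (Fin n → F)) :
    (LinearMap.toMatrix' f.toLinearMap).det ≠ 0 := by
  rw [LinearMap.det_toMatrix']
  exact f.isUnit_det'.ne_zero

theorem exists_linearEquiv_toMatrix' {n : ℕ} (A : Matrix (Fin n) (Fin n) F) (hA : A.det ≠ 0) :
    ∃ f : (Fin n → F) ≃ₗ[F] (Fin n → F), LinearMap.toMatrix' f.toLinearMap = A := by
  refine ⟨Matrix.toLin'OfInv (Matrix.nonsing_inv_mul A hA.isUnit)
    (Matrix.mul_nonsing_inv A hA.isUnit), ?_⟩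
  apply Matrix.toLin'.injective
  rw [Matrix.toLin'_toMatrix']
  rfl

theorem exists_mem_groupH_iff (s t : Space F) :
    (∃ h ∈ groupH F (Fin 2 → F) (Fin 3 → F) (Fin 3 → F), h s = t) ↔
      PencilEquiv (toPencil F s) (toPencil F t) := by
  constructor
  · rintro ⟨_, ⟨⟨g₁, g₂, g₃⟩, rfl⟩, rfl⟩
    exact ⟨_, _, _, det_toMatrix'_ne_zero g₁, det_toMatrix'_ne_zero g₂,
      by rw [Matrix.det_transpose]; exact det_toMatrix'_ne_zero g₃,
      fun i => toPencil_map g₁.toLinearMap g₂.toLinearMap g₃.toLinearMap s i⟩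
  · rintro ⟨g, P, Q, hg, hP, hQ, h⟩
    obtain ⟨g₁, rfl⟩ := exists_linearEquiv_toMatrix' g hg
    obtain ⟨g₂, rfl⟩ := exists_linearEquiv_toMatrix' P hP
    obtain ⟨g₃, hg₃⟩ := exists_linearEquiv_toMatrix' Qᵀ (by simpa using hQ)
    refine ⟨_, ⟨⟨g₁, g₂, g₃⟩, rfl⟩, ?_⟩
    apply (toPencil F).injective
    ext i : 1
    rw [h]
    refine (toPencil_map g₁.toLinearMap g₂.toLinearMap g₃.toLinearMap s i).trans ?_
    rw [hg₃, Matrix.transpose_transpose]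

theorem orbitRel_groupH_iff (s t : Space F) :
    MulAction.orbitRel (groupH F (Fin 2 → F) (Fin 3 → F) (Fin 3 → F)) (Space F) s t ↔
      PencilEquiv (toPencil F s) (toPencil F t) := by
  rw [Setoid.comm', MulAction.orbitRel_apply, ← exists_mem_groupH_iff]
  constructor
  · rintro ⟨⟨h, hh⟩, rfl⟩
    exact ⟨h, hh, rfl⟩
  · rintro ⟨h, hh, rfl⟩
    exact ⟨⟨h, hh⟩, rfl⟩

/-- The interchange of the two factors `F³` transposes the matrices of the pencil, and modulo `H` it
is the only further element of `G`. -/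
theorem orbitRel_groupG_iff (s t : Space F) :
    MulAction.orbitRel (groupG F (Fin 2 → F) (Fin 3 → F) (Fin 3 → F)) (Space F) s t ↔
      PencilEquiv (toPencil F s) (toPencil F t) ∨
      PencilEquiv (toPencil F s) (fun i => (toPencil F t i)ᵀ) := by
  rw [Setoid.comm', MulAction.orbitRel_apply]
  constructor
  · rintro ⟨⟨g, hg⟩, rfl⟩
    obtain ⟨h, hh, rfl | rfl⟩ := mem_groupH_or_of_mem_groupG (by simp) hg
    · exact Or.inl ((exists_mem_groupH_iff _ _).1 ⟨_, hh, rfl⟩)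
    · refine Or.inr ?_
      have := (exists_mem_groupH_iff s (h s)).1 ⟨h, hh, rfl⟩
      convert this using 2 with i
      change (toPencil F (swapLast F _ _ (h s)) i)ᵀ = _
      rw [toPencil_swapLast, Matrix.transpose_transpose]
  · rintro (h | h)
    · obtain ⟨k, hk, rfl⟩ := (exists_mem_groupH_iff _ _).2 h
      exact ⟨⟨k, groupH_le_groupG hk⟩, rfl⟩
    · have e : (fun i => (toPencil F t i)ᵀ) =
          toPencil F (swapLast F (Fin 2 → F) (Fin 3 → F) t) :=
        funext fun i => (toPencil_swapLast t i).symm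
      rw [e] at h
      obtain ⟨k, hk, hst⟩ := (exists_mem_groupH_iff _ _).2 h
      refine ⟨⟨swapLast F _ _ * k, mul_mem swapLast_mem_groupG (groupH_le_groupG hk)⟩, ?_⟩
      change swapLast F _ _ (k s) = t
      rw [hst]
      apply (toPencil F).injective
      ext i : 1
      rw [toPencil_swapLast, toPencil_swapLast, Matrix.transpose_transpose]

end Coordinates

/-! ### Counting the orbits -/

section Counting

/-- The normal form of the transposed pencil. -/
def transposeIndex : Fin 20 → Fin 20 :=
  ![0, 1, 2, 3, 15, 5, 6, 16, 17, 9, 10, 11, 12, 13, 14, 4, 7, 8, 18, 19]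

theorem transpose_normalForm (i : Fin 20) :
    (fun j => (normalForm F i j)ᵀ) = normalForm F (transposeIndex i) := by
  ext j k l
  fin_cases i <;> fin_cases j <;> fin_cases k <;> fin_cases l <;> rfl

/-- The bound `n` is 18 for algebraically closed and 20 for real closed fields. The index separates
the first `n` forms, and `hsurj` says that they exhaust all pencils. -/
theorem card_hOrbits {n : ℕ}
    (hindex : ∀ i : Fin 20, i.val < n → (normalForm F i).index = i)
    (hsurj : ∀ T : Pencil F, ∃ i : Fin 20, i.val < n ∧ PencilEquiv T (normalForm F i)) :
    Nat.card (HOrbits F) = Fintype.card {i : Fin 20 // i.val < n} := by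
  rw [← Nat.card_eq_fintype_card]
  refine (Nat.card_congr (Equiv.ofBijective (fun i : {i : Fin 20 // i.val < n} =>
    (Quotient.mk _ ((toPencil F).symm (normalForm F i.1)) : HOrbits F)) ⟨?_, ?_⟩)).symm
  · rintro ⟨i, hi⟩ ⟨j, hj⟩ hij
    have h := (orbitRel_groupH_iff _ _).1 (Quotient.exact hij)
    simp only [LinearEquiv.apply_symm_apply] at h
    have := Pencil.index_eq_of_equiv h
    rw [hindex i hi, hindex j hj] at this
    exact Subtype.ext (Fin.ext this)
  · intro q
    obtain ⟨t, rfl⟩ := Quotient.exists_rep q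
    obtain ⟨i, hi, h⟩ := hsurj (toPencil F t)
    refine ⟨⟨i, hi⟩, Quotient.sound ((orbitRel_groupH_iff _ _).2 ?_)⟩
    simpa using h.symm

/-- The indices 15, 16 and 17 are left out because transposition sends them to 4, 7 and 8. -/
theorem card_gOrbits {n : ℕ} (hn : 18 ≤ n)
    (hindex : ∀ i : Fin 20, i.val < n → (normalForm F i).index = i)
    (hsurj : ∀ T : Pencil F, ∃ i : Fin 20, i.val < n ∧ PencilEquiv T (normalForm F i)) :
    Nat.card (GOrbits F) =
      Fintype.card {i : Fin 20 // i.val < n ∧ (i.val < 15 ∨ 18 ≤ i.val)} := by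
  -- Transposition preserves the first eighteen indices and fixes the last two, so it respects the
  -- bound `n`.
  have ht : ∀ i, i < 18 ∧ transposeIndex i < 18 ∨ transposeIndex i = i := by decide
  have ht' : ∀ i : Fin 20, i.val < n → (transposeIndex i).val < n := by
    intro i hi
    rcases ht i with h | h
    · exact lt_of_lt_of_le h.2 hn
    · rwa [h]
  rw [← Nat.card_eq_fintype_card]
  refine (Nat.card_congr (Equiv.ofBijective
    (fun i : {i : Fin 20 // i.val < n ∧ (i.val < 15 ∨ 18 ≤ i.val)} =>
    (Quotient.mk _ ((toPencil F).symm (normalForm F i.1)) : GOrbits F)) ⟨?_, ?_⟩)).symm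
  · rintro ⟨i, hi, hi'⟩ ⟨j, hj, hj'⟩ hij
    have h := (orbitRel_groupG_iff _ _).1 (Quotient.exact hij)
    simp only [LinearEquiv.apply_symm_apply] at h
    rw [transpose_normalForm] at h
    have hd : ∀ i j : Fin 20, (i.val < 15 ∨ 18 ≤ i.val) → (j.val < 15 ∨ 18 ≤ j.val) →
      i = transposeIndex j → i = j := by decide
    rcases h with h | h
    · have := Pencil.index_eq_of_equiv h
      rw [hindex i hi, hindex j hj] at this
      exact Subtype.ext (Fin.ext this)
    · have := Pencil.index_eq_of_equiv h
      rw [hindex i hi, hindex _ (ht' j hj)] at this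
      exact Subtype.ext (hd i j hi' hj' (Fin.ext this))
  · intro q
    obtain ⟨t, rfl⟩ := Quotient.exists_rep q
    obtain ⟨i, hi, h⟩ := hsurj (toPencil F t)
    by_cases hi' : i.val < 15 ∨ 18 ≤ i.val
    · refine ⟨⟨i, hi, hi'⟩, Quotient.sound ((orbitRel_groupG_iff _ _).2 (Or.inl ?_))⟩
      simpa using h.symm
    · have hd : ∀ i : Fin 20, ¬ (i.val < 15 ∨ 18 ≤ i.val) →
        ((transposeIndex i).val < 15 ∨ 18 ≤ (transposeIndex i).val) := by decide
      refine ⟨⟨transposeIndex i, ht' i hi, hd i hi'⟩,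
        Quotient.sound ((orbitRel_groupG_iff _ _).2 (Or.inr ?_))⟩
      rw [LinearEquiv.apply_symm_apply, ← transpose_normalForm]
      exact h.symm.transpose

end Counting

/-! ### Singular members and constant-rank pencils -/

section Roots

open Polynomial

/-- If `A` is invertible, `det (X A + B)` is a cubic polynomial with leading coefficient `det A`. -/
theorem exists_det_eq_zero (hF : ∀ f : F[X], f.natDegree = 3 → ∃ x, f.IsRoot x)
    (A B : Matrix (Fin 3) (Fin 3) F) :
    ∃ x : Fin 2 → F, x ≠ 0 ∧ (x 0 • A + x 1 • B).det = 0 := by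
  by_cases hA : A.det = 0
  · exact ⟨![1, 0], by simp, by simpa using hA⟩
  obtain ⟨t, ht⟩ := hF (det ((X : F[X]) • A.map C + B.map C)) (by
    refine le_antisymm (by simpa using natDegree_det_X_add_C_le A B) ?_
    apply le_natDegree_of_ne_zero
    simpa using (coeff_det_X_add_C_card A B).trans_ne hA)
  refine ⟨![t, 1], by simp, ?_⟩
  rw [IsRoot, ← coe_evalRingHom, RingHom.map_det] at ht
  convert ht using 2
  ext i j
  simpa using mul_comm _ _

/-- A left kernel vector `w` with `w k ≠ 0` expresses row `k` through the other two rows, so `t` is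
a sum of two terms, each with one of these rows as right factor. -/
theorem tensorRank_le_two {t : (Fin 3 → F) ⊗[F] (Fin 3 → F)} (ht : (toMat F t).det = 0) :
    tensorRank t ≤ 2 := by
  classical
  obtain ⟨w, hw, hwM⟩ := Matrix.exists_vecMul_eq_zero_iff.2 ht
  obtain ⟨k, hk⟩ := Function.ne_iff.1 hw
  rw [Pi.zero_apply] at hk
  set M := toMat F t with hM
  let y : Fin 2 → Fin 3 → F := fun j =>
    Pi.single (k.succAbove j) 1 - Pi.single k (w (k.succAbove j) / w k)
  have hy : ∀ j, y j ≠ 0 := by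
    intro j h
    have := congrFun h (k.succAbove j)
    simp [y, Fin.succAbove_ne] at this
  have hsum : t = ∑ j, y j ⊗ₜ[F] M (k.succAbove j) := by
    apply (toMat F).injective
    rw [← hM, map_sum]
    ext i l
    have hl := congrFun hwM l
    simp only [Matrix.vecMul, dotProduct, Pi.zero_apply] at hl
    rw [Fin.sum_univ_succAbove _ k] at hl
    simp only [toMat_tmul, Matrix.sum_apply, vecMulVec_apply]
    rcases Fin.eq_self_or_eq_succAbove k i with rfl | ⟨j, rfl⟩
    · have hne : ∀ j, y j i = -(w (i.succAbove j) / w i) := fun j => by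
        simp [y]
      simp only [hne, neg_mul, Finset.sum_neg_distrib, div_mul_eq_mul_div, ← Finset.sum_div]
      rw [eq_neg_iff_add_eq_zero]
      field_simp
      linear_combination hl
    · have hne : ∀ j', y j' (k.succAbove j) = if j' = j then 1 else 0 := fun j' => by
        simp [y, Pi.single_apply, eq_comm]
      simp [hne]
  -- Fundamental tensors need nonzero factors, so a zero row is replaced by a basis vector; only
  -- membership in the span is required.
  refine Nat.sInf_le ⟨fun j => y j ⊗ₜ[F]
    (if M (k.succAbove j) = 0 then Pi.single 0 1 else M (k.succAbove j)), fun j => ?_, ?_⟩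
  · refine ⟨y j, _, hy j, ?_, rfl⟩
    split_ifs with h
    · simp
    · exact h
  · rw [hsum]
    refine Submodule.sum_mem _ fun j _ => ?_
    by_cases h : M (k.succAbove j) = 0
    · rw [h, TensorProduct.tmul_zero]
      exact Submodule.zero_mem _
    · exact Submodule.subset_span ⟨j, by simp [h]⟩

theorem not_exists_isConstantRankPencil
    (hF : ∀ f : F[X], f.natDegree = 3 → ∃ x, f.IsRoot x) :
    ¬ ∃ L : Submodule F ((Fin 3 → F) ⊗[F] (Fin 3 → F)), IsConstantRankPencil 3 L := by
  rintro ⟨L, hL, hrank⟩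
  have hL' : Module.finrank F (L.map (toMat F).toLinearMap) = 2 :=
    (LinearEquiv.finrank_map_eq (toMat F) L).trans hL
  have : Module.Finite F (L.map (toMat F).toLinearMap) :=
    Module.finite_of_finrank_pos (by omega)
  let b := Module.finBasisOfFinrankEq F _ hL'
  obtain ⟨s₀, hs₀, h₀⟩ := (b 0).2
  obtain ⟨s₁, hs₁, h₁⟩ := (b 1).2
  obtain ⟨x, hx, hdet⟩ := exists_det_eq_zero hF (b 0 : Matrix (Fin 3) (Fin 3) F) (b 1)
  have e : toMat F (x 0 • s₀ + x 1 • s₁) =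
      ((x 0 • b 0 + x 1 • b 1 : L.map (toMat F).toLinearMap) : Matrix (Fin 3) (Fin 3) F) := by
    rw [map_add, map_smul, map_smul]
    exact congrArg₂ (fun A B => x 0 • A + x 1 • B) h₀ h₁
  have hne : x 0 • s₀ + x 1 • s₁ ≠ 0 := by
    intro h
    rw [h, map_zero] at e
    refine hx (funext (Fintype.linearIndependent_iff.1 b.linearIndependent x ?_))
    rw [Fin.sum_univ_two]
    exact Subtype.ext e.symm
  have h3 := hrank _ (L.add_mem (L.smul_mem (x 0) hs₀) (L.smul_mem (x 1) hs₁)) hne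
  have h2 := tensorRank_le_two ((congrArg Matrix.det e).trans hdet)
  omega

end Roots

/-! ### Algebraically closed and real closed fields -/

section Fields

open Polynomial

theorem exists_normalForm_of_isAlgClosed {F : Type*} [Field F] [IsAlgClosed F] (T : Pencil F) :
    ∃ i : Fin 20, i.val < 18 ∧ PencilEquiv T (normalForm F i) := by
  have hroot : ∀ f : F[X], f.natDegree ≠ 0 → ∃ x, f.IsRoot x := fun f hf =>
    IsAlgClosed.exists_root f fun h => hf (natDegree_eq_of_degree_eq_some h)
  obtain ⟨x, hx, h⟩ := exists_det_eq_zero (fun f hf => hroot f (by omega)) (T 0) (T 1)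
  rcases isClassified_of_exists_det_eq_zero T x hx h with ⟨i, hi, h⟩ | ⟨a, p, q, -, hpq, -⟩
  · exact ⟨i, hi, h⟩
  · obtain ⟨y, hy⟩ := hroot (X ^ 2 + C p * X + C q) (by
      have : (X ^ 2 + C p * X + C q : F[X]).natDegree = 2 := by compute_degree!
      omega)
    exact absurd (by simpa using hy) (hpq y)

theorem exists_ne_zero_one_add_ne_zero_of_infinite (F : Type*) [Field F] [Infinite F] :
    ∃ t : F, t ≠ 0 ∧ 1 + t ≠ 0 := by
  classical
  obtain ⟨t, ht⟩ := Infinite.exists_notMem_finset ({0, -1} : Finset F)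
  simp only [Finset.mem_insert, Finset.mem_singleton, not_or] at ht
  exact ⟨t, ht.1, fun h => ht.2 (by linear_combination h)⟩

variable [IsRealClosed F]

theorem not_isSquare_neg_one_of_isRealClosed (s : F) : s * s ≠ -1 := by
  intro h
  apply IsSemireal.not_isSumSq_neg_one (R := F)
  rw [← h]
  exact IsSumSq.mul_self s

theorem two_ne_zero_of_isRealClosed : (2 : F) ≠ 0 := fun h =>
  not_isSquare_neg_one_of_isRealClosed (1 : F) (by linear_combination h)

theorem eq_zero_of_mul_self_add_mul_self {s t : F} (h : s * s + t * t = 0) : s = 0 ∧ t = 0 := by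
  have ht : t = 0 := by
    by_contra ht
    apply not_isSquare_neg_one_of_isRealClosed (s / t)
    field_simp
    linear_combination h
  subst ht
  exact ⟨by simpa using h, rfl⟩

theorem exists_normalForm_of_isRealClosed (T : Pencil F) :
    ∃ i : Fin 20, i.val < 20 ∧ PencilEquiv T (normalForm F i) := by
  obtain ⟨x, hx, h⟩ := exists_det_eq_zero (fun f hf =>
    IsRealClosed.exists_isRoot_of_odd_natDegree (by rw [hf]; decide)) (T 0) (T 1)
  rcases isClassified_of_exists_det_eq_zero T x hx h with ⟨i, hi, h⟩ | ⟨a, p, q, ha, hpq, h⟩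
  · exact ⟨i, i.isLt, h⟩
  have h2 := two_ne_zero_of_isRealClosed (F := F)
  obtain ⟨m, rfl⟩ : ∃ m, p = 2 * m := ⟨p / 2, by field_simp⟩
  -- Completing the square: if `m² - q = r²` then `r - m` would be a root of the quadratic, so `q -
  -- m²` must be the square.
  obtain ⟨r, hr⟩ : IsSquare (q - m * m) := by
    refine (IsRealClosed.isSquare_or_isSquare_neg _).resolve_right ?_
    rintro ⟨r, hr⟩
    exact hpq (r - m) (by linear_combination -hr)
  obtain rfl : q = r * r + m * m := by linear_combination hr
  have hr0 : r ≠ 0 := by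
    rintro rfl
    exact hpq (-m) (by ring)
  -- The shift by `m` makes the block traceless with determinant `r²`, and scaling by `r⁻¹` makes
  -- this 1. The last equivalence turns the identity block into the antidiagonal one and the first
  -- block into `diag(1, -1)`.
  have key : PencilEquiv T
      ![!![a, 0, 0; 0, 1, 0; 0, 0, -1], !![0, 0, 0; 0, 0, 1; 0, 1, 0]] := by
    refine (h.trans (.shift _ _ m)).trans ((PencilEquiv.of_comb _ _ r⁻¹ 0 0 1
      (by simpa using hr0)).trans (.of_mul !![r, 0, 0; 0, 0, r; 0, 1, -m]
      !![1, 0, 0; 0, 1, m * r⁻¹; 0, 0, r⁻¹] ?_ ?_ ?_ ?_))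
    · simp [det_fin_three, hr0]
    · simp [det_fin_three, hr0]
    · ext i j
      fin_cases i <;> fin_cases j <;> simp [hr0] <;> field_simp <;> ring
    · ext i j
      fin_cases i <;> fin_cases j <;> simp [hr0]
  rcases ha with rfl | rfl
  · exact ⟨18, by decide, key⟩
  · exact ⟨19, by decide, key⟩

end Fields

/-- For odd degree and nonnegative leading coefficient a polynomial tends to `±∞` at `±∞`, so by
continuity it is surjective. The other sign follows by negation. -/
instance : IsRealClosed ℝ :=
  IsRealClosed.of_linearOrderedField (fun {x} hx => ⟨√x, (Real.mul_self_sqrt hx).symm⟩) <| by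
    have pos : ∀ f : Polynomial ℝ, Odd f.natDegree → 0 ≤ f.leadingCoeff → ∃ x, f.IsRoot x := by
      intro f hf hc
      have hdeg : 0 < f.degree := Polynomial.natDegree_pos_iff_degree_pos.1 hf.pos
      have htop := f.tendsto_atTop_of_leadingCoeff_nonneg hdeg hc
      have hnat : (f.comp (-Polynomial.X)).natDegree = f.natDegree := by
        rw [Polynomial.natDegree_comp]; simp
      -- Substituting `-X` reverses the sign of the leading coefficient, as the degree is odd.
      have hbot : Filter.Tendsto (fun x => f.eval x) Filter.atBot Filter.atBot := by
        have h := (f.comp (-Polynomial.X)).tendsto_atBot_of_leadingCoeff_nonpos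
          (Polynomial.natDegree_pos_iff_degree_pos.1 (by rw [hnat]; exact hf.pos))
          (by rw [Polynomial.leadingCoeff_comp (by simp)]; simp [hf.neg_one_pow, hc])
        have h' := h.comp Filter.tendsto_neg_atBot_atTop
        refine h'.congr fun x => ?_
        simp
      obtain ⟨x, hx⟩ := f.continuous.surjective htop hbot 0
      exact ⟨x, hx⟩
    intro f hf
    rcases le_total 0 f.leadingCoeff with h | h
    · exact pos f hf h
    · obtain ⟨x, hx⟩ := pos (-f) (by simpa using hf) (by simpa using h)
      exact ⟨x, by simpa [Polynomial.IsRoot] using hx⟩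

theorem card_orbits_of_isRealClosed (F : Type*) [Field F] [IsRealClosed F] :
    Nat.card (HOrbits F) = 20 ∧ Nat.card (GOrbits F) = 17 := by
  have hindex : ∀ i : Fin 20, i.val < 20 → (normalForm F i).index = i := fun i _ =>
    index_normalForm ⟨1, one_ne_zero, by
      rw [one_add_one_eq_two]; exact two_ne_zero_of_isRealClosed⟩ i
      (Or.inr fun s t => eq_zero_of_mul_self_add_mul_self)
  exact ⟨(card_hOrbits hindex exists_normalForm_of_isRealClosed).trans (by decide),
    (card_gOrbits (by decide) hindex exists_normalForm_of_isRealClosed).trans (by decide)⟩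

theorem card_orbits_of_isAlgClosed (F : Type*) [Field F] [IsAlgClosed F] :
    Nat.card (HOrbits F) = 18 ∧ Nat.card (GOrbits F) = 15 := by
  have : Infinite F := IsAlgClosed.instInfinite
  have hindex : ∀ i : Fin 20, i.val < 18 → (normalForm F i).index = i := fun i hi =>
    index_normalForm (exists_ne_zero_one_add_ne_zero_of_infinite F) i (Or.inl hi)
  exact ⟨(card_hOrbits hindex exists_normalForm_of_isAlgClosed).trans (by decide),
    (card_gOrbits le_rfl hindex exists_normalForm_of_isAlgClosed).trans (by decide)⟩

end TensorOrbits

theorem mainTheorem4 :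
    (∀ (F : Type*) [Field F] [IsAlgClosed F],
      (¬ ∃ L : Submodule F ((Fin 3 → F) ⊗[F] (Fin 3 → F)),
        TensorOrbits.IsConstantRankPencil 3 L) ∧
      Nat.card (TensorOrbits.HOrbits F) = 18 ∧ Nat.card (TensorOrbits.GOrbits F) = 15) ∧
    (∀ (F : Type*) [Field F] [IsRealClosed F],
      (¬ ∃ L : Submodule F ((Fin 3 → F) ⊗[F] (Fin 3 → F)),
        TensorOrbits.IsConstantRankPencil 3 L) ∧
      Nat.card (TensorOrbits.HOrbits F) = 20 ∧ Nat.card (TensorOrbits.GOrbits F) = 17) ∧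
    (Nat.card (TensorOrbits.HOrbits ℝ) = 20 ∧ Nat.card (TensorOrbits.GOrbits ℝ) = 17) := by
  refine ⟨fun F _ _ => ⟨?_, TensorOrbits.card_orbits_of_isAlgClosed F⟩,
    fun F _ _ => ⟨?_, TensorOrbits.card_orbits_of_isRealClosed F⟩,
    TensorOrbits.card_orbits_of_isRealClosed ℝ⟩
  · refine TensorOrbits.not_exists_isConstantRankPencil fun f hf =>
      IsAlgClosed.exists_root f fun h => ?_
    rw [Polynomial.natDegree_eq_of_degree_eq_some h] at hf
    exact absurd hf (by decide)
  · exact TensorOrbits.not_exists_isConstantRankPencil fun f hf =>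
      IsRealClosed.exists_isRoot_of_odd_natDegree (by rw [hf]; decide)
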